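/- Let $m\ge 1$, let $a_0,a_1,a_2,\dots$ be indeterminates over $\mathbb Q$ and put $u_j=-a_j/a_m$. Let $R_m(k)$ be the $\mathbb Q$-span of the monomials of degree $k$ in the $u_j$, $j\ne m$, and let $R_m$ be the ring of formal graded sums $\sum_{k\ge 0} r(k)$ with $r(k)\in R_m(k)$. Infinite sums below are taken degree by degree. **Trees.** A generalized Łukasiewicz word is a finite sequence of integers $l_1,\dots,l_N$, all $\neq 1$, with $\sum_{i\le n}(l_i-1)\ge 0$ for $n<N$ and $\sum_{i\le N}(l_i-1)=-1$; $\mathrm{Luk}_m$ is the set of those with all $l_i\ge -m+1$. Replacing every letter $l_i<0$ by $|l_i|+1$ zeros gives the preorder degree sequence of a plane tree $U(T)$; the word is identified with the tree $T$ (with negative vertex degree) obtained from $U(T)$ by giving the last of these $|l_i|+1$ leaves the degree $l_i$ and calling the other $|l_i|$ leaves canceled. $T_0$ is the one-vertex tree $(0)$. The root subtrees of $T$ are those of $U(T)$ with their degrees, where vertices canceled from outside a subtree count as vertices of degree $0$ and a one-vertex subtree counts as $T_0$. The type of a plane tree is $0$ for a single vertex; it is $n+1$ if exactly one root subtree has type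 $n+1$ and the others type at most $n$, or if at least two root subtrees have type $n$ and the others type less than $n$. Let $\mathrm{type}(T)=\mathrm{type}(U(T))$, let $\mathrm{terminal}(T)$ be the number of zeros at the right end of the word, and $R_m(T)=\prod_i u_{m+l_i-1}$. For $0\le i\le m-1$ let $\mathrm{Luk}_{i,m}$ be the set of $T\in\mathrm{Luk}_m$, $T\ne T_0$, with $\min(m-1,\mathrm{terminal}(T))=i$. Put $$J_{i,m}(n)=\sum_{T\in \mathrm{Luk}_{i,m},\ \mathrm{type}(T)=n}R_m(T),\qquad S_{i,m}(n)=\sum_{k=1}^nJ_{i,m}(k),\qquad \mathbf S_m(n)=(S_{0,m}(n),\dots,S_{m-1,m}(n)).$$ **Auxiliary functions.** A partial block is one of the following, with the stated length and expression in the variables $x_0,\dots,x_{m-1}$: $(i)$ with $0\le i\le m-1$, length $1$, expression $x_i$; $(T_0)$, length $1$, expression $u_{m-1}$; $(i,k,h)$ with $1\le h\le m-1$, $2\le k\le h+1$, $h-(k-2)\le i\le m-1$, length $k$, expression $x_i\,u_{m-1}^{k-2-h}\,u_{m-1-h}$; $(T_0,k,k-1)$ with $2\le k\le m$, length $k$,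 expression $u_{m-k}$. A partial tree $\overline T$ is a finite sequence of partial blocks. If $d$ is the sum of their lengths, its expression $R_m(\overline T)$ is $u_{m-1+d}$ times the product of the expressions of its blocks if $d\ge 2$, and $0$ otherwise. If $\overline T$ ends in exactly $r$ blocks $(T_0)$, then $\mathrm{terminal}(\overline T)=\min(m-1,r+i)$ when these are preceded by a block $(i)$, and $\min(m-1,r)$ otherwise. Let $$f_{i,m}(x_0,\dots,x_{m-1})=\sum_{\mathrm{terminal}(\overline T)=i}R_m(\overline T),$$ a power series in $x_0,\dots,x_{m-1}$ whose coefficients are formal graded sums in the $u_j$ and $u_{m-1}^{-1}$. **Theorem.** All sums above are well defined; sums of $R_m(T)$ over subsets of $\mathrm{Luk}_m$ lie in $R_m$; the values of $f_{i,m}$ and $\partial f_{i,m}/\partial x_j$ used below are well defined; and the following hold. 1. For $X\subseteq \mathrm{Luk}_m$ let $\mathbf S(X)=(S_0(X),\dots,S_{m-1}(X))$ with $S_i(X)=\sum_{T\in X\cap \mathrm{Luk}_{i,m}}R_m(T)$. For $0\le i\le m-1$, $$f_{i,m}(\mathbf S(X))=\sum_T R_m(T),$$ the sum being over all $T\in\mathrm{Luk}_{i,m}$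 all of whose root subtrees with root degree $\ge 2$ lie in $X$. 2. If moreover $0\le j\le m-1$, $T_1\in \mathrm{Luk}_{j,m}$ and $T_1\notin X$, then $$R_m(T_1)\,\frac{\partial f_{i,m}}{\partial x_j}(\mathbf S(X))=\sum_T R_m(T),$$ the sum being over all $T\in\mathrm{Luk}_{i,m}$ with exactly one root subtree equal to $T_1$ and whose root subtrees different from $T_1$ with root degree $\ge 2$ lie in $X$. 3. For a power series $F$ in $x_0,\dots,x_{m-1}$ and $n\ge 1$ put $$L_m(F,n)=F(\mathbf S_m(n-1))+\sum_{j=0}^{m-1}J_{j,m}(n)\frac{\partial F}{\partial x_j}(\mathbf S_m(n-1)).$$ Then for all $0\le i\le m-1$ and $n\ge 1$, $$J_{i,m}(1)=L_m(f_{i,m},1),\qquad J_{i,m}(n+1)=L_m(f_{i,m},n+1)-L_m(f_{i,m},n).$$ The first family is a linear system in the unknowns $J_{0,m}(1),\dots,J_{m-1,m}(1)$; given the $J_{i,m}(k)$ with $k\le n$, the second is a linear system in the unknowns $J_{0,m}(n+1),\dots,J_{m-1,m}(n+1)$. -/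

import Mathlib

noncomputable section

namespace NRS

/-! ### Generalized Łukasiewicz words and trees with negative vertex degree -/

/-- A plane tree whose vertices carry labels in `α`: a root label and the ordered list of root
subtrees. -/
inductive PlaneTree (α : Type) : Type where
  | node : α → List (PlaneTree α) → PlaneTree α

/-- The ordered list of root subtrees. -/
def PlaneTree.children {α : Type} : PlaneTree α → List (PlaneTree α)
  | .node _ ts => ts

/-- The labels read in preorder (depth-first order). -/
def PlaneTree.preorder {α : Type} : PlaneTree α → List α
  | .node a ts => a :: ts.attach.flatMap (fun t => t.1.preorder)
termination_by t => t
decreasing_by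
  have := List.sizeOf_lt_of_mem t.2
  simp
  omega

/-- The type number of a plane tree (the labels play no role). A single vertex has type `0`.
Otherwise let `M` be the largest type of a root subtree: if it occurs at least twice, the type is
`M + 1` (all other root subtrees have type `< M`; the tree is final); if it occurs exactly once,
the type is `M` (all other root subtrees have type at most `M - 1`). -/
def PlaneTree.typeNumber {α : Type} : PlaneTree α → ℕ
  | .node _ ts =>
    let τ : List ℕ := ts.attach.map (fun t => t.1.typeNumber)
    let M : ℕ := τ.foldr max 0
    if ts = [] then 0 else if 2 ≤ τ.count M then M + 1 else M
termination_by t => t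
decreasing_by
  have := List.sizeOf_lt_of_mem t.2
  simp
  omega

/-- Generalized Łukasiewicz words: no letter is `1`, all proper initial sums of `l_i - 1` are
nonnegative, and the total sum is `-1`. -/
def IsGenLukWord (l : List ℤ) : Prop :=
  (∀ d ∈ l, d ≠ 1) ∧
  (∀ n < l.length, 0 ≤ ((l.take n).map (fun d => d - 1)).sum) ∧
  (l.map (fun d => d - 1)).sum = -1

/-- `Luk_m`: the generalized Łukasiewicz words all of whose letters are at least `-m+1`. A tree with
negative vertex degree is identified with its preorder sequence of vertex degrees. -/
def Luk (m : ℕ) : Set (List ℤ) :=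
  {l | IsGenLukWord l ∧ ∀ d ∈ l, -(m : ℤ) + 1 ≤ d}

/-- The tree `T₀` consisting of a single vertex. -/
def T0 : List ℤ := [0]

/-- The word of the underlying plane tree, with labels: a letter `d < 0` is replaced by `|d| + 1`
leaves, the last of which has degree `d` while the `|d|` leaves before it are canceled.
The label `some d` means "vertex of degree `d`", the label `none` means "canceled vertex". -/
def expand (l : List ℤ) : List (Option ℤ) :=
  l.flatMap (fun d => if d < 0 then List.replicate d.natAbs none ++ [some d] else [some d])

/-- The number of subtrees of a vertex with the given label. -/
def arity : Option ℤ → ℕ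
  | none => 0
  | some d => d.toNat

/-- The forest whose preorder sequence of labels is the given word. -/
def parse : List (Option ℤ) → List (PlaneTree (Option ℤ))
  | [] => []
  | a :: w => .node a ((parse w).take (arity a)) :: (parse w).drop (arity a)

/-- The tree with negative vertex degree whose preorder sequence is `l`: the underlying plane tree,
each vertex being labelled by its degree or as canceled. -/
def toTree (l : List ℤ) : PlaneTree (Option ℤ) :=
  (parse (expand l)).headD (.node (some 0) [])

/-- `type(T)`, the type number of the underlying plane tree. -/
def typeNumber (l : List ℤ) : ℕ := (toTree l).typeNumber

/-- A root subtree, regarded as a tree with negative vertex degree in its own right. If it is a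
single vertex, it is `T₀` (a negative degree is assigned to it only within the big tree). Otherwise
its vertices canceled from outside the subtree, which are the canceled vertices at the end of its
preorder, are vertices of degree `0` again, and the other canceled vertices stay canceled. -/
def restore : PlaneTree (Option ℤ) → List ℤ
  | .node _ [] => T0
  | .node a (t :: ts) =>
    let w := (PlaneTree.node a (t :: ts)).preorder
    w.reduceOption ++ List.replicate (w.rtakeWhile (fun x => x.isNone)).length 0

/-- The root subtrees `T_1, ..., T_k` of the tree `T`, from left to right. -/
def rootSubtrees (l : List ℤ) : List (List ℤ) := (toTree l).children.map restore

/-- The degree of the root. -/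
def rootDegree (l : List ℤ) : ℤ := l.headD 0

/-- `terminal(T)`: the number of consecutive zeros at the right end of the preorder sequence. -/
def terminal (l : List ℤ) : ℕ := (l.rtakeWhile (fun d => d = 0)).length

/-- `Luk_{i,m}` for `0 ≤ i ≤ m - 1`. -/
def LukPart (m i : ℕ) : Set (List ℤ) :=
  {l | l ∈ Luk m ∧ l ≠ T0 ∧ if i = m - 1 then m - 1 ≤ terminal l else terminal l = i}

/-- `Luk_{i,m}(n)`: the trees of type `n` in `Luk_{i,m}`. -/
def LukType (m i n : ℕ) : Set (List ℤ) := {l | l ∈ LukPart m i ∧ typeNumber l = n}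

/-- `Subtrees_m(X)`. -/
def subtreesIn (m : ℕ) (X : Set (List ℤ)) : Set (List ℤ) :=
  {l | l ∈ Luk m ∧ ∀ t ∈ rootSubtrees l, 2 ≤ rootDegree t → t ∈ X}

/-- `Subtrees_m(X, T₁)`: exactly one root subtree equals `T₁`, and those different from `T₁` with
root degree at least `2` lie in `X`. -/
def subtreesInWith (m : ℕ) (X : Set (List ℤ)) (T₁ : List ℤ) : Set (List ℤ) :=
  {l | l ∈ Luk m ∧ (rootSubtrees l).count T₁ = 1 ∧
    ∀ t ∈ rootSubtrees l, t ≠ T₁ → 2 ≤ rootDegree t → t ∈ X}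

/-! ### Graded infinite sums and the ring `R_m` -/

/-- The field of rational functions over `ℚ` in the indeterminates `a_0, a_1, a_2, ...`. -/
abbrev K : Type := FractionRing (MvPolynomial ℕ ℚ)

/-- The indeterminate `a_k`. -/
def a (k : ℕ) : K := algebraMap (MvPolynomial ℕ ℚ) K (MvPolynomial.X k)

/-- Graded infinite sums `∑ r(k)`, the sum being over the integers `k ≥ k₀` for some `k₀`, with the
usual operations: the coefficient at `k` is the piece `r(k)` of degree `k`. -/
abbrev L : Type := LaurentSeries K

/-- `-a_j / a_m`, an element of degree `1`. -/
def u (m j : ℕ) : L := HahnSeries.single 1 (-(a j) / a m)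

/-- `R_m(k)`: the `ℚ`-span of the monomials of degree `k` in the `-a_j / a_m`, `j ≠ m`
(with `j = m - 1 + i`, the condition `i ≥ -m + 1` reads `j ≥ 0` and `i ≠ 1` reads `j ≠ m`). -/
def gradedPiece (m k : ℕ) : Submodule ℚ K :=
  Submodule.span ℚ {x | ∃ n : ℕ →₀ ℕ, n m = 0 ∧ (n.sum fun _ e => e) = k ∧
    x = n.prod fun j e => (-(a j) / a m) ^ e}

lemma one_mem_gradedPiece (m : ℕ) : (1 : K) ∈ gradedPiece m 0 :=
  Submodule.subset_span ⟨0, by simp, by simp, by simp⟩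

lemma mul_mem_gradedPiece (m k k' : ℕ) {x y : K} (hx : x ∈ gradedPiece m k)
    (hy : y ∈ gradedPiece m k') : x * y ∈ gradedPiece m (k + k') := by
  induction hx using Submodule.span_induction with
  | mem x hx =>
    induction hy using Submodule.span_induction with
    | mem y hy =>
      obtain ⟨n, h1, h2, rfl⟩ := hx
      obtain ⟨n', h1', h2', rfl⟩ := hy
      refine Submodule.subset_span ⟨n + n', by simp [h1, h1'], ?_, ?_⟩
      · rw [Finsupp.sum_add_index' (by simp) (by simp), h2, h2']
      · rw [Finsupp.prod_add_index' (by simp) (by intros; exact pow_add _ _ _)]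
    | zero => simp
    | add y z _ _ h1 h2 => rw [mul_add]; exact add_mem h1 h2
    | smul c y _ h => rw [mul_smul_comm]; exact Submodule.smul_mem _ _ h
  | zero => simp
  | add x z _ _ h1 h2 => rw [add_mul]; exact add_mem h1 h2
  | smul c x _ h => rw [smul_mul_assoc]; exact Submodule.smul_mem _ _ h

/-- The ring `R_m`: the sums `∑_{k ≥ 0} r(k)` with `r(k) ∈ R_m(k)`. -/
def R (m : ℕ) : Subring L where
  carrier := {r | (∀ k : ℤ, k < 0 → r.coeff k = 0) ∧ ∀ k : ℕ, r.coeff (k : ℤ) ∈ gradedPiece m k}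
  zero_mem' := by simp
  one_mem' := by
    refine ⟨fun k hk => by simp [HahnSeries.coeff_one, hk.ne], fun k => ?_⟩
    rw [HahnSeries.coeff_one]
    split_ifs with h
    · obtain rfl : k = 0 := by exact_mod_cast h
      exact one_mem_gradedPiece m
    · exact zero_mem _
  add_mem' := by
    rintro r s ⟨h1, h2⟩ ⟨h1', h2'⟩
    exact ⟨fun k hk => by simp [h1 k hk, h1' k hk], fun k => add_mem (h2 k) (h2' k)⟩
  neg_mem' := by
    rintro r ⟨h1, h2⟩
    exact ⟨fun k hk => by simp [h1 k hk], fun k => neg_mem (h2 k)⟩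
  mul_mem' := by
    rintro r s ⟨h1, h2⟩ ⟨h1', h2'⟩
    have hr : ∀ i ∈ r.support, 0 ≤ i := fun i hi => by
      by_contra h
      exact hi (h1 i (not_le.mp h))
    have hs : ∀ i ∈ s.support, 0 ≤ i := fun i hi => by
      by_contra h
      exact hi (h1' i (not_le.mp h))
    refine ⟨fun k hk => ?_, fun k => ?_⟩
    · rw [HahnSeries.coeff_mul]
      refine Finset.sum_eq_zero fun ij hij => ?_
      rw [Finset.mem_antidiagonal] at hij
      have := hr _ hij.1
      have := hs _ hij.2.1
      have := hij.2.2
      omega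
    · rw [HahnSeries.coeff_mul]
      refine Submodule.sum_mem _ fun ij hij => ?_
      rw [Finset.mem_antidiagonal] at hij
      obtain ⟨i, hi⟩ := Int.eq_ofNat_of_zero_le (hr _ hij.1)
      obtain ⟨j, hj⟩ := Int.eq_ofNat_of_zero_le (hs _ hij.2.1)
      have hk := hij.2.2
      rw [hi, hj] at hk ⊢
      obtain rfl : i + j = k := by exact_mod_cast hk
      exact mul_mem_gradedPiece m i j (h2 i) (h2' j)

/-- A family of graded sums has a well-defined sum: the degrees that occur are bounded below (a set
of integers is partially well-ordered iff it is bounded below), and in each degree only finitely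
many members contribute. -/
def FormallySummable {ι : Type} (s : ι → L) : Prop :=
  (⋃ x, (s x).support).IsPWO ∧ ∀ k : ℤ, {x | (s x).coeff k ≠ 0}.Finite

open Classical in
/-- The sum of a family, taken degree by degree (`0` if the family is not summable). -/
def formalSum {ι : Type} (s : ι → L) : L :=
  if h : FormallySummable s then (HahnSeries.SummableFamily.mk s h.1 h.2).hsum else 0

/-- `R_m(T)`: the product of `-a_{m+d-1} / a_m` over the degrees `d` of the vertices of `T` that are
not canceled. -/
def treeExpr (m : ℕ) (l : List ℤ) : L :=
  (l.map (fun d => u m ((m : ℤ) + d - 1).toNat)).prod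

/-- `∑_{T ∈ X} R_m(T)`. -/
def treeSum (m : ℕ) (X : Set (List ℤ)) : L := formalSum (fun T : X => treeExpr m T.1)

/-- `J_{i,m}(n)`. -/
def J (m : ℕ) (i : Fin m) (n : ℕ) : L := treeSum m (LukType m i n)

/-- The vector with entries `S_{i,m}(n) = ∑_{k=1}^n J_{i,m}(k)`. -/
def S (m n : ℕ) (i : Fin m) : L := ∑ k ∈ Finset.Icc 1 n, J m i k

/-- The vector with entries `S_i(X) = ∑_{T ∈ X ∩ Luk_{i,m}} R_m(T)`. -/
def SOf (m : ℕ) (X : Set (List ℤ)) (i : Fin m) : L := treeSum m (X ∩ LukPart m i)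

/-! ### Partial trees and the auxiliary functions -/

/-- Partial blocks: `(i)`, `(T₀)`, `(i, k, h)` and `(T₀, k, k - 1)`. -/
inductive PartialBlock (m : ℕ) : Type where
  | one (i : Fin m) : PartialBlock m
  | oneT0 : PartialBlock m
  | triple (i : Fin m) (k h : ℕ) (h_pos : 1 ≤ h) (h_le : h ≤ m - 1) (k_ge : 2 ≤ k)
      (k_le : k ≤ h + 1) (i_ge : (h : ℤ) - ((k : ℤ) - 2) ≤ (i : ℕ)) : PartialBlock m
  | tripleT0 (k : ℕ) (k_ge : 2 ≤ k) (k_le : k ≤ m) : PartialBlock m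

/-- The length of a partial block. -/
def PartialBlock.length {m : ℕ} : PartialBlock m → ℕ
  | .one _ => 1
  | .oneT0 => 1
  | .triple _ k _ _ _ _ _ _ => k
  | .tripleT0 k _ _ => k

/-- The `R_m`-expression of a partial block, a monomial in the variables `x_i` whose coefficient is
a Laurent monomial in the `-a_j / a_m`. -/
def PartialBlock.expr {m : ℕ} : PartialBlock m → MvPolynomial (Fin m) L
  | .one i => MvPolynomial.X i
  | .oneT0 => MvPolynomial.C (u m (m - 1))
  | .triple i k h _ _ _ _ _ =>
      MvPolynomial.X i * MvPolynomial.C (u m (m - 1) ^ ((k : ℤ) - 2 - (h : ℤ))) *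
        MvPolynomial.C (u m (m - 1 - h))
  | .tripleT0 k _ _ => MvPolynomial.C (u m (m - 1 - (k - 1)))

/-- Partial trees (without empty subtrees): finite sequences of partial blocks. -/
abbrev PartialTree (m : ℕ) : Type := List (PartialBlock m)

/-- The degree of the root of a partial tree. -/
def PartialTree.rootDegree {m : ℕ} (T : PartialTree m) : ℕ := (T.map PartialBlock.length).sum

/-- Number of terminal zeros forced by a sequence of partial blocks that is read from right to left:
a block `(T₀)` contributes one zero and the count goes on to its left, a block `(i)` contributes
`i`, and a triple ends with a vertex of negative degree. -/
def terminalAux {m : ℕ} : List (PartialBlock m) → ℕ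
  | [] => 0
  | .oneT0 :: bs => terminalAux bs + 1
  | .one i :: _ => i
  | .triple _ _ _ _ _ _ _ _ :: _ => 0
  | .tripleT0 _ _ _ :: _ => 0

/-- `terminal` of a partial tree: the index `i` such that all trees that are mapped to it by
forgetting everything about the first tree of each block but its number of terminal zeros (capped at
`m - 1`) and whether it is `T₀`, lie in `Luk_{i,m}`. -/
def PartialTree.terminal {m : ℕ} (T : PartialTree m) : ℕ := min (m - 1) (terminalAux T.reverse)

/-- The `R_m`-expression of a partial tree. -/
def PartialTree.expr {m : ℕ} (T : PartialTree m) : MvPolynomial (Fin m) L :=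
  if 2 ≤ PartialTree.rootDegree T then
    MvPolynomial.C (u m (m - 1 + PartialTree.rootDegree T)) * (T.map PartialBlock.expr).prod
  else 0

/-- The auxiliary function `f_{i,m}(x_0, ..., x_{m-1})`: the sum of the expressions of all partial
trees with `terminal` equal to `i`, as a power series in the `x_j`; each coefficient is a formal
sum. -/
def auxFun (m : ℕ) (i : Fin m) : MvPowerSeries (Fin m) L :=
  fun α => formalSum
    (fun T : {T : PartialTree m // PartialTree.terminal T = i} =>
      MvPolynomial.coeff α (PartialTree.expr T.1))

/-- The value of the power series `F` at `v` is well defined. -/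
def EvalSummable {m : ℕ} (F : MvPowerSeries (Fin m) L) (v : Fin m → L) : Prop :=
  FormallySummable (fun α : Fin m →₀ ℕ => MvPowerSeries.coeff α F * ∏ j, v j ^ α j)

/-- The value `F(v)` of the power series `F` at `v`. -/
def evalAt {m : ℕ} (F : MvPowerSeries (Fin m) L) (v : Fin m → L) : L :=
  formalSum (fun α : Fin m →₀ ℕ => MvPowerSeries.coeff α F * ∏ j, v j ^ α j)

/-- `∂F/∂x_j`. -/
def partialDeriv {m : ℕ} (j : Fin m) (F : MvPowerSeries (Fin m) L) : MvPowerSeries (Fin m) L :=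
  MvPowerSeries.pderiv L j F

/-- `L_m(F, n)`, for `n ≥ 1`. -/
def linearPart (m : ℕ) (F : MvPowerSeries (Fin m) L) (n : ℕ) : L :=
  evalAt F (S m (n - 1)) + ∑ j : Fin m, J m j n * evalAt (partialDeriv j F) (S m (n - 1))

end NRS

end

noncomputable section

namespace NRS

/-! Read the word behind the root letter `d` of a tree as a walk with steps `l_i - 1` from height
`d`, and end a block as soon as the height falls below its value at the start of the block. A block
with drop `k` describes `k` consecutive root subtrees. If `k = 1`, it is one whole subtree. If `k ≥
2`, it ends with a letter `-h`. Either it is that letter alone, with `h = k - 1`, and all its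
subtrees are `T₀`; or the `h + 1` leaves of that letter first replace the last `h + 2 - k` zeros of
the first subtree and then form `k - 1` subtrees `T₀`. So a block is determined by its kind and its
first tree, which only needs enough terminal zeros; capping their number at `m - 1` loses nothing
because `h ≤ m - 1`. First passages form a prefix code, hence trees other than `T₀` correspond
bijectively to sequences of blocks with chosen first trees (`bijOn_treeWord`), and forgetting the
first trees leaves a partial tree.

Expressions are multiplicative over blocks, and a block expression is constant or linear in one
variable. Summing over first trees from `X` therefore evaluates a partial tree at `S(X)`
(`sumOn_seqFillings`), while the Leibniz rule selects the one block that is filled with a tree `T₁ ∉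
X` (`sumOn_seqFillingsWith`). Grouping trees by their partial tree (`sumOn_partialTrees`) yields the
substitution and derivative properties.

A tree has type at most `n + 1` iff all root subtrees have type at most `n`, or exactly one has type
`n + 1` and the others have type at most `n` (`typeOf_le_iff`). With `X` the trees of type at most
`n`, the value of `f` counts the first kind and the first derivatives count the second, so `L_m(f, n
+ 1) = S(n + 1)` (`linearPart_auxFun`); differences give the linear systems.

For convergence, `x_j` gets weight `j + 1`, a lower bound for the degrees in `S_j(X)`. Every block
then has weight at least `1`, so only finitely many partial trees matter in each degree, and
`sumOn_eval` permits evaluation term by term. -/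

/-! ### Sums over sets of indices -/

/-- All coefficients of degree less than `n` vanish. -/
def LowBd (n : ℤ) (x : L) : Prop := ∀ k < n, x.coeff k = 0

lemma LowBd.mono {n n' : ℤ} {x : L} (h : LowBd n x) (hn : n' ≤ n) : LowBd n' x :=
  fun k hk => h k (hk.trans_le hn)

lemma lowBd_zero (n : ℤ) : LowBd n 0 := fun _ _ => by simp

lemma lowBd_sum {ι : Type*} {n : ℤ} (s : Finset ι) (f : ι → L) (h : ∀ x ∈ s, LowBd n (f x)) :
    LowBd n (∑ x ∈ s, f x) :=
  fun k hk => by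
    rw [HahnSeries.coeff_sum]
    exact Finset.sum_eq_zero fun x hx => h x hx k hk

lemma LowBd.mul {n n' : ℤ} {x y : L} (hx : LowBd n x) (hy : LowBd n' y) :
    LowBd (n + n') (x * y) := by
  intro k hk
  rw [HahnSeries.coeff_mul]
  refine Finset.sum_eq_zero fun ij hij => ?_
  rw [Finset.mem_antidiagonal] at hij
  rcases lt_or_ge ij.1 n with h | h
  · rw [hx _ h, zero_mul]
  · rw [hy ij.2 (by have := hij.2.2; omega), mul_zero]

lemma lowBd_single (n : ℤ) (c : K) : LowBd n (HahnSeries.single n c : L) :=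
  fun _ hk => HahnSeries.coeff_single_of_ne hk.ne

lemma lowBd_one : LowBd 0 (1 : L) := lowBd_single 0 1

lemma exists_lowBd (x : L) : ∃ n, LowBd n x := by
  by_cases hx : x = 0
  · exact ⟨0, hx ▸ lowBd_zero 0⟩
  · exact ⟨x.order, fun k hk => HahnSeries.coeff_eq_zero_of_lt_order hk⟩

variable {ι κ : Type}

/-- The family `s` has a well-defined sum over the set `A`. -/
def SummableOn (A : Set ι) (s : ι → L) : Prop :=
  (∃ n, ∀ x ∈ A, LowBd n (s x)) ∧ ∀ k : ℤ, {x | x ∈ A ∧ (s x).coeff k ≠ 0}.Finite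

/-- The family `s` has the sum `r` over the set `A`. -/
def SumOn (A : Set ι) (s : ι → L) (r : L) : Prop :=
  SummableOn A s ∧ ∀ k : ℤ, r.coeff k = ∑ᶠ x ∈ A, (s x).coeff k

lemma exists_lowBd_of_isPWO {s : ι → L} (h : (⋃ x, (s x).support).IsPWO) :
    ∃ n, ∀ x, LowBd n (s x) := by
  rcases (⋃ x, (s x).support).eq_empty_or_nonempty with h0 | h0
  · refine ⟨0, fun x k _ => ?_⟩
    by_contra hk
    have : k ∈ ⋃ x, (s x).support := Set.mem_iUnion.mpr ⟨x, hk⟩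
    simp [h0] at this
  · refine ⟨h.isWF.min h0, fun x k hk => ?_⟩
    by_contra hk'
    exact h.isWF.not_lt_min h0 (Set.mem_iUnion.mpr ⟨x, hk'⟩) hk

lemma isPWO_of_lowBd {s : ι → L} {n : ℤ} (h : ∀ x, LowBd n (s x)) :
    (⋃ x, (s x).support).IsPWO := by
  refine Set.IsWF.isPWO (BddBelow.isWF ⟨n, fun k hk => ?_⟩)
  obtain ⟨x, hx⟩ := Set.mem_iUnion.mp hk
  by_contra hk'
  exact hx (h x k (not_le.mp hk'))

/-- Passing from subtypes to subsets of a fixed index type makes regrouping and re-indexing possible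
without coercions. -/
lemma formallySummable_coe_iff {A : Set ι} {s : ι → L} :
    FormallySummable (fun x : A => s x) ↔ SummableOn A s := by
  have hset : ∀ k : ℤ, {x : ι | x ∈ A ∧ (s x).coeff k ≠ 0} =
      Subtype.val '' {x : A | (s x).coeff k ≠ 0} := fun k => by
    ext x; simp [and_comm]
  constructor
  · rintro ⟨h1, h2⟩
    obtain ⟨n, hn⟩ := exists_lowBd_of_isPWO h1
    exact ⟨⟨n, fun x hx => hn ⟨x, hx⟩⟩, fun k => hset k ▸ (h2 k).image _⟩
  · rintro ⟨⟨n, hn⟩, h2⟩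
    refine ⟨isPWO_of_lowBd (n := n) fun x => hn x x.2, fun k => ?_⟩
    have := h2 k
    rw [hset] at this
    exact this.of_finite_image Subtype.val_injective.injOn

lemma formallySummable_iff {s : ι → L} : FormallySummable s ↔ SummableOn Set.univ s := by
  constructor
  · rintro ⟨h1, h2⟩
    obtain ⟨n, hn⟩ := exists_lowBd_of_isPWO h1
    exact ⟨⟨n, fun x _ => hn x⟩, fun k => by simpa using h2 k⟩
  · rintro ⟨⟨n, hn⟩, h2⟩
    exact ⟨isPWO_of_lowBd fun x => hn x trivial, fun k => by simpa using h2 k⟩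

lemma coeff_formalSum {s : ι → L} (h : FormallySummable s) (k : ℤ) :
    (formalSum s).coeff k = ∑ᶠ x, (s x).coeff k := by
  rw [formalSum, dif_pos h, HahnSeries.SummableFamily.coeff_hsum]
  rfl

lemma SummableOn.sumOn_coe {A : Set ι} {s : ι → L} (h : SummableOn A s) :
    SumOn A s (formalSum fun x : A => s x) :=
  ⟨h, fun k => by
    rw [coeff_formalSum (formallySummable_coe_iff.mpr h)]
    exact finsum_set_coe_eq_finsum_mem (f := fun x => (s x).coeff k) A⟩

lemma SummableOn.sumOn_univ {s : ι → L} (h : SummableOn Set.univ s) :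
    SumOn Set.univ s (formalSum s) :=
  ⟨h, fun k => by rw [coeff_formalSum (formallySummable_iff.mpr h), finsum_mem_univ]⟩

lemma SumOn.unique {A : Set ι} {s : ι → L} {r r' : L} (h : SumOn A s r) (h' : SumOn A s r') :
    r = r' := by
  ext k
  rw [h.2, h'.2]

lemma SummableOn.congr {A : Set ι} {s t : ι → L} (h : SummableOn A s) (hst : ∀ x ∈ A, s x = t x) :
    SummableOn A t := by
  obtain ⟨⟨n, hn⟩, h2⟩ := h
  exact ⟨⟨n, fun x hx => hst x hx ▸ hn x hx⟩,
    fun k => (h2 k).subset fun x hx => ⟨hx.1, by rw [hst x hx.1]; exact hx.2⟩⟩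

lemma SumOn.congr {A : Set ι} {s t : ι → L} {r : L} (h : SumOn A s r)
    (hst : ∀ x ∈ A, s x = t x) : SumOn A t r :=
  ⟨h.1.congr hst, fun k => (h.2 k).trans (finsum_mem_congr rfl fun x hx => by rw [hst x hx])⟩

lemma SumOn.lowBd {A : Set ι} {s : ι → L} {r : L} (h : SumOn A s r) {n : ℤ}
    (hn : ∀ x ∈ A, LowBd n (s x)) : LowBd n r :=
  fun k hk => (h.2 k).trans (finsum_mem_eq_zero_of_forall_eq_zero fun x hx => hn x hx k hk)

lemma sumOn_empty (s : ι → L) : SumOn ∅ s 0 :=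
  ⟨⟨⟨0, by simp⟩, by simp⟩, by simp⟩

lemma sumOn_singleton (s : ι → L) (x : ι) : SumOn {x} s (s x) := by
  obtain ⟨n, hn⟩ := exists_lowBd (s x)
  exact ⟨⟨⟨n, by simpa using hn⟩, fun k => (Set.finite_singleton x).subset fun y hy => hy.1⟩,
    by simp⟩

/-- In each degree only finitely many `x` contribute, and a fibre contributes only if one of its
members does, so regrouping reduces to a finite sum. All later rearrangements rest on this. -/
lemma SumOn.fiberwise {A : Set ι} {s : ι → L} {r : L} (h : SumOn A s r) {B : Set κ} {p : ι → κ}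
    (hp : Set.MapsTo p A B) {g : κ → L} (hg : ∀ y ∈ B, SumOn {x | x ∈ A ∧ p x = y} s (g y)) :
    SumOn B g r := by
  classical
  obtain ⟨⟨⟨n, hn⟩, hfin⟩, hr⟩ := h
  have hsub : ∀ k, {y | y ∈ B ∧ (g y).coeff k ≠ 0} ⊆ p '' {x | x ∈ A ∧ (s x).coeff k ≠ 0} := by
    rintro k y ⟨hy, hk⟩
    rw [(hg y hy).2] at hk
    obtain ⟨x, hx, hx'⟩ := exists_ne_zero_of_finsum_mem_ne_zero hk
    exact ⟨x, ⟨hx.1, hx'⟩, hx.2⟩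
  refine ⟨⟨⟨n, fun y hy => (hg y hy).lowBd fun x hx => hn x hx.1⟩,
    fun k => ((hfin k).image p).subset (hsub k)⟩, fun k => ?_⟩
  set F := (hfin k).toFinset with hF
  have hF' : ∀ x, x ∈ F ↔ x ∈ A ∧ (s x).coeff k ≠ 0 := fun x => by simp [hF]
  rw [hr, finsum_mem_eq_sum_of_inter_support_eq (t := F),
    finsum_mem_eq_sum_of_inter_support_eq (t := F.image p),
    ← Finset.sum_fiberwise_of_maps_to (g := p) (fun x hx => Finset.mem_image_of_mem p hx)]
  · refine Finset.sum_congr rfl fun y hy => ?_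
    obtain ⟨x, hx, rfl⟩ := Finset.mem_image.mp hy
    rw [(hg _ (hp ((hF' x).mp hx).1)).2, finsum_mem_eq_sum_of_inter_support_eq]
    ext z
    simp only [Set.mem_inter_iff, Set.mem_ofPred_eq, Function.mem_support, Finset.coe_filter, hF']
    tauto
  · ext y
    simp only [Set.mem_inter_iff, Function.mem_support, Finset.coe_image]
    constructor
    · rintro ⟨hy, hy'⟩
      obtain ⟨x, hx, rfl⟩ := hsub k ⟨hy, hy'⟩
      exact ⟨⟨x, (hF' x).mpr hx, rfl⟩, hy'⟩
    · rintro ⟨⟨x, hx, rfl⟩, hy'⟩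
      exact ⟨hp ((hF' x).mp hx).1, hy'⟩
  · ext x
    simp only [Set.mem_inter_iff, Function.mem_support, Finset.mem_coe, hF']
    tauto

lemma SumOn.of_bijOn {A : Set ι} {B : Set κ} {s : ι → L} {t : κ → L} {r : L} (h : SumOn A s r)
    {e : ι → κ} (he : Set.BijOn e A B) (hst : ∀ x ∈ A, t (e x) = s x) : SumOn B t r := by
  refine h.fiberwise he.mapsTo fun y hy => ?_
  obtain ⟨x, hx, rfl⟩ := he.surjOn hy
  have : {z | z ∈ A ∧ e z = e x} = {x} := by
    ext z
    exact ⟨fun hz => he.injOn hz.1 hx hz.2, by rintro rfl; exact ⟨hx, rfl⟩⟩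
  rw [this, hst x hx]
  exact sumOn_singleton s x

lemma SummableOn.of_bijOn {A : Set ι} {B : Set κ} {s : ι → L} {t : κ → L} (h : SummableOn B t)
    {e : ι → κ} (he : Set.BijOn e A B) (hst : ∀ x ∈ A, t (e x) = s x) : SummableOn A s := by
  obtain ⟨⟨n, hn⟩, h2⟩ := h
  refine ⟨⟨n, fun x hx => hst x hx ▸ hn _ (he.mapsTo hx)⟩, fun k => ?_⟩
  refine Set.Finite.of_finite_image ((h2 k).subset ?_) (he.injOn.mono fun x hx => hx.1)
  rintro _ ⟨x, hx, rfl⟩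
  exact ⟨he.mapsTo hx.1, by rw [hst x hx.1]; exact hx.2⟩

/-- Summability pulls back along the bijection; pushing the resulting sum forward identifies it with
`r`. -/
lemma SumOn.of_bijOn' {A : Set ι} {B : Set κ} {s : ι → L} {t : κ → L} {r : L} (h : SumOn B t r)
    {e : ι → κ} (he : Set.BijOn e A B) (hst : ∀ x ∈ A, t (e x) = s x) : SumOn A s r := by
  have h1 := (h.1.of_bijOn he hst).sumOn_coe
  rwa [h.unique (h1.of_bijOn he hst)]

lemma SumOn.union {A B : Set ι} {s : ι → L} {r r' : L} (h : SumOn A s r) (h' : SumOn B s r')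
    (hAB : Disjoint A B) : SumOn (A ∪ B) s (r + r') := by
  obtain ⟨⟨⟨n, hn⟩, hf⟩, hr⟩ := h
  obtain ⟨⟨⟨n', hn'⟩, hf'⟩, hr'⟩ := h'
  refine ⟨⟨⟨min n n', ?_⟩, fun k => ((hf k).union (hf' k)).subset ?_⟩, fun k => ?_⟩
  · rintro x (hx | hx)
    · exact (hn x hx).mono (min_le_left _ _)
    · exact (hn' x hx).mono (min_le_right _ _)
  · rintro x ⟨hx | hx, h⟩
    · exact Or.inl ⟨hx, h⟩
    · exact Or.inr ⟨hx, h⟩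
  · rw [HahnSeries.coeff_add, hr, hr', finsum_mem_union' hAB (hf k) (hf' k)]

lemma SumOn.prod {A : Set ι} {B : Set κ} {s : ι → L} {t : κ → L} {r r' : L} (h : SumOn A s r)
    (h' : SumOn B t r') : SumOn (A ×ˢ B) (fun p => s p.1 * t p.2) (r * r') := by
  have hA := formallySummable_coe_iff.mpr h.1
  have hB := formallySummable_coe_iff.mpr h'.1
  let F : HahnSeries.SummableFamily ℤ K A := .mk (fun x : A => s x) hA.1 hA.2
  let G : HahnSeries.SummableFamily ℤ K B := .mk (fun x : B => t x) hB.1 hB.2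
  have hF : r = F.hsum := by
    ext k
    rw [h.2, HahnSeries.SummableFamily.coeff_hsum]
    exact (finsum_set_coe_eq_finsum_mem (f := fun x => (s x).coeff k) A).symm
  have hG : r' = G.hsum := by
    ext k
    rw [h'.2, HahnSeries.SummableFamily.coeff_hsum]
    exact (finsum_set_coe_eq_finsum_mem (f := fun x => (t x).coeff k) B).symm
  have hFG : SumOn Set.univ (fun p : A × B => s p.1 * t p.2) (r * r') := by
    rw [hF, hG, ← HahnSeries.SummableFamily.hsum_mul]
    refine ⟨formallySummable_iff.mp ⟨(F.mul G).isPWO_iUnion_support,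
      (F.mul G).finite_co_support⟩, fun k => ?_⟩
    rw [HahnSeries.SummableFamily.coeff_hsum, finsum_mem_univ]
    rfl
  refine hFG.of_bijOn (e := fun p => (p.1.1, p.2.1)) ⟨?_, ?_, ?_⟩ fun _ _ => rfl
  · rintro ⟨x, y⟩ _
    exact ⟨x.2, y.2⟩
  · rintro ⟨x, y⟩ _ ⟨x', y'⟩ _ hxy
    simpa [Prod.ext_iff, Subtype.ext_iff] using hxy
  · rintro ⟨x, y⟩ ⟨hx, hy⟩
    exact ⟨(⟨x, hx⟩, ⟨y, hy⟩), trivial, rfl⟩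

lemma SumOn.const_mul {A : Set ι} {s : ι → L} {r : L} (h : SumOn A s r) (c : L) :
    SumOn A (fun x => c * s x) (c * r) :=
  ((sumOn_singleton (fun _ : Unit => c) ()).prod h).of_bijOn (e := Prod.snd)
    ⟨fun _ hp => hp.2, fun _ _ _ _ h => Prod.ext rfl h, fun x hx => ⟨((), x), ⟨rfl, hx⟩, rfl⟩⟩
    fun _ _ => rfl

/-- A finite family is summable. -/
lemma sumOn_finset (A : Finset ι) (s : ι → L) : SumOn (A : Set ι) s (∑ x ∈ A, s x) := by
  classical
  induction A using Finset.induction_on with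
  | empty => simpa using sumOn_empty s
  | insert x A hx ih =>
    rw [Finset.sum_insert hx, Finset.coe_insert, Set.insert_eq]
    exact (sumOn_singleton s x).union ih (by simpa using hx)

lemma sumOn_zero {A : Set ι} {s : ι → L} (h : ∀ x ∈ A, s x = 0) : SumOn A s 0 :=
  ⟨⟨⟨0, fun x hx => h x hx ▸ lowBd_zero 0⟩,
    fun k => Set.finite_empty.subset fun x hx => hx.2 (by rw [h x hx.1]; simp)⟩,
    fun k => (finsum_mem_eq_zero_of_forall_eq_zero fun x hx => by rw [h x hx]; simp).symm⟩

/-- Indices outside of `A` do not matter if the family vanishes there. -/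
lemma SumOn.superset {A B : Set ι} {s : ι → L} {r : L} (h : SumOn A s r) (hAB : A ⊆ B)
    (h0 : ∀ x ∈ B, x ∉ A → s x = 0) : SumOn B s r := by
  have := h.union (sumOn_zero (A := B \ A) fun x hx => h0 x hx.1 hx.2) disjoint_sdiff_self_right
  rwa [add_zero, Set.union_sdiff_cancel hAB] at this

/-! ### Paths, words and forests -/

/-- A walk with the given steps that starts at height `q`, is positive before each step, and ends
at height `e`. -/
def Path : ℤ → List ℤ → ℤ → Prop
  | q, [], e => q = e
  | q, x :: l, e => 0 < q ∧ Path (q + x) l e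

lemma path_append {q e : ℤ} {l l' : List ℤ} :
    Path q (l ++ l') e ↔ ∃ c, Path q l c ∧ Path c l' e := by
  induction l generalizing q with
  | nil => simp [Path]
  | cons x l ih => simp [Path, ih, and_assoc]

lemma Path.append {q c e : ℤ} {l l' : List ℤ} (h : Path q l c) (h' : Path c l' e) :
    Path q (l ++ l') e :=
  path_append.mpr ⟨c, h, h'⟩

lemma Path.eq_add_sum {q e : ℤ} {l : List ℤ} (h : Path q l e) : e = q + l.sum := by
  induction l generalizing q with
  | nil => simp [show q = e from h]
  | cons x l ih => rw [ih h.2, List.sum_cons, add_assoc]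

lemma Path.add {q e : ℤ} {l : List ℤ} (h : Path q l e) {c : ℤ} (hc : 0 ≤ c) :
    Path (q + c) l (e + c) := by
  induction l generalizing q with
  | nil => simpa [Path] using h
  | cons x l ih =>
    refine ⟨by have := h.1; omega, ?_⟩
    have := ih h.2
    rwa [show q + c + x = q + x + c by ring]

lemma path_replicate (n : ℕ) (e : ℤ) (he : 0 ≤ e) : Path (n + e) (List.replicate n (-1)) e := by
  induction n with
  | zero => simp [Path]
  | succ n ih =>
    rw [List.replicate_succ]
    refine ⟨by push_cast; omega, ?_⟩
    rwa [show ((n + 1 : ℕ) : ℤ) + e + -1 = n + e by push_cast; ring]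

lemma path_iff {q e : ℤ} {l : List ℤ} :
    Path q l e ↔ (∀ n < l.length, 0 < q + (l.take n).sum) ∧ q + l.sum = e := by
  induction l generalizing q with
  | nil => simp [Path]
  | cons x l ih =>
    rw [Path, ih]
    constructor
    · rintro ⟨h0, h1, h2⟩
      refine ⟨fun n hn => ?_, by rw [← h2, List.sum_cons, add_assoc]⟩
      cases n with
      | zero => simpa using h0
      | succ n =>
        have := h1 n (by simpa using hn)
        simpa [add_assoc] using this
    · rintro ⟨h1, h2⟩
      refine ⟨by simpa using h1 0 (by simp), fun n hn => ?_,
        by rw [← h2, List.sum_cons, add_assoc]⟩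
      have := h1 (n + 1) (by simpa using hn)
      simpa [add_assoc] using this

/-- Walks that stop when they become nonpositive form a prefix code. -/
lemma Path.prefix_unique {q e e' : ℤ} {p p' l l' : List ℤ} (h : Path q p e) (he : e ≤ 0)
    (h' : Path q p' e') (he' : e' ≤ 0) (hl : p ++ l = p' ++ l') : p.length = p'.length := by
  induction p generalizing q p' with
  | nil =>
    cases p' with
    | nil => rfl
    | cons x p' =>
      have h1 := h'.1
      have h2 : q = e := h
      omega
  | cons x p ih =>
    cases p' with
    | nil =>
      have h1 := h.1
      have h2 : q = e' := h'
      omega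
    | cons x' p' =>
      simp only [List.cons_append, List.cons.injEq] at hl
      obtain ⟨rfl, hl⟩ := hl
      simp [ih h.2 h'.2 hl]

/-- Lowered by `c`, the walk ends at `-c ≤ 0`, so it becomes nonpositive at some point; `p` is the
segment up to the first such point. -/
lemma Path.exists_first_passage {c q : ℤ} (hc : 0 ≤ c) {l : List ℤ} (h : Path (c + q) l 0) :
    ∃ p l' e, l = p ++ l' ∧ e ≤ 0 ∧ Path q p e ∧ Path (c + e) l' 0 := by
  induction l generalizing q with
  | nil =>
    have h : c + q = 0 := h
    exact ⟨[], [], q, rfl, by omega, rfl, h⟩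
  | cons x l ih =>
    by_cases hq : q ≤ 0
    · exact ⟨[], x :: l, q, rfl, hq, rfl, h⟩
    · obtain ⟨p, l', e, rfl, he, h1, h2⟩ := ih (q := q + x) (by rw [← add_assoc]; exact h.2)
      exact ⟨x :: p, l', e, rfl, he, ⟨by omega, h1⟩, h2⟩

/-- The walk of a word: a letter `d` contributes a step `d - 1`. -/
def WordPath (q : ℤ) (l : List ℤ) (e : ℤ) : Prop := Path q (l.map fun d => d - 1) e

/-- Starting at height `1` turns nonnegative proper initial sums into positivity before every step.
-/
lemma isGenLukWord_iff {l : List ℤ} :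
    IsGenLukWord l ↔ (∀ d ∈ l, d ≠ 1) ∧ WordPath 1 l 0 := by
  rw [IsGenLukWord, WordPath, path_iff]
  refine and_congr_right fun _ => and_congr ?_ ?_
  · simp only [List.length_map, ← List.map_take]
    exact forall₂_congr fun n _ => by omega
  · omega

/-- The letters that are allowed in words of `Luk m`. -/
def Letters (m : ℕ) (l : List ℤ) : Prop := ∀ d ∈ l, d ≠ 1 ∧ -(m : ℤ) + 1 ≤ d

lemma mem_luk_iff {m : ℕ} {l : List ℤ} : l ∈ Luk m ↔ Letters m l ∧ WordPath 1 l 0 := by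
  simp only [Luk, Set.mem_ofPred_eq, isGenLukWord_iff, Letters]
  constructor
  · rintro ⟨⟨h1, h2⟩, h3⟩
    exact ⟨fun d hd => ⟨h1 d hd, h3 d hd⟩, h2⟩
  · rintro ⟨h1, h2⟩
    exact ⟨⟨fun d hd => (h1 d hd).1, h2⟩, fun d hd => (h1 d hd).2⟩

lemma letters_append {m : ℕ} {l l' : List ℤ} :
    Letters m (l ++ l') ↔ Letters m l ∧ Letters m l' :=
  List.forall_mem_append

lemma letters_cons {m : ℕ} {d : ℤ} {l : List ℤ} :
    Letters m (d :: l) ↔ (d ≠ 1 ∧ -(m : ℤ) + 1 ≤ d) ∧ Letters m l := by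
  simp [Letters]

lemma wordPath_cons {q e d : ℤ} {l : List ℤ} :
    WordPath q (d :: l) e ↔ 0 < q ∧ WordPath (q + (d - 1)) l e := Iff.rfl

lemma wordPath_append {q e : ℤ} {l l' : List ℤ} :
    WordPath q (l ++ l') e ↔ ∃ c, WordPath q l c ∧ WordPath c l' e := by
  simp [WordPath, path_append]

lemma WordPath.add {q e c q' e' : ℤ} {l : List ℤ} (h : WordPath q l e) (hc : 0 ≤ c)
    (hq : q' = q + c) (he : e' = e + c) : WordPath q' l e' := by
  subst hq he
  exact Path.add h hc

lemma wordPath_replicate (n : ℕ) : WordPath n (List.replicate n 0) 0 := by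
  simpa [WordPath] using path_replicate n 0 le_rfl

/-- A tree other than `T0` begins with its root degree `d ≥ 2`, followed by a word that describes
`d` root subtrees. -/
lemma exists_cons_of_mem_luk {m : ℕ} {l : List ℤ} (h : l ∈ Luk m) (h0 : l ≠ T0) :
    ∃ d : ℕ, 2 ≤ d ∧ ∃ l', l = (d : ℤ) :: l' ∧ WordPath d l' 0 := by
  rw [mem_luk_iff] at h
  obtain ⟨h1, h2⟩ := h
  cases l with
  | nil => exact absurd (show (1 : ℤ) = 0 from h2) one_ne_zero
  | cons d l =>
    have hd := (letters_cons.mp h1).1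
    have h2 : WordPath (1 + (d - 1)) l 0 := h2.2
    rw [add_sub_cancel] at h2
    have hd2 : 2 ≤ d := by
      cases l with
      | nil => exact absurd (by rw [show d = 0 from h2]; rfl) h0
      | cons y l =>
        have := h2.1
        omega
    obtain ⟨n, rfl⟩ := Int.eq_ofNat_of_zero_le (by omega : 0 ≤ d)
    exact ⟨n, by omega, l, rfl, h2⟩

lemma T0_mem_luk {m : ℕ} (hm : 1 ≤ m) : T0 ∈ Luk m := by
  rw [mem_luk_iff]
  refine ⟨by simp [Letters, T0]; omega, by simp [WordPath, T0, Path]⟩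

/-! ### Parsing -/

lemma preorder_node {α : Type} (x : α) (ts : List (PlaneTree α)) :
    (PlaneTree.node x ts).preorder = x :: ts.flatMap PlaneTree.preorder := by
  rw [PlaneTree.preorder]
  simp [List.flatMap]

/-- The type number of a tree whose root subtrees have the given type numbers. -/
def typeOf (τ : List ℕ) : ℕ :=
  if τ = [] then 0 else if 2 ≤ τ.count (τ.foldr max 0) then τ.foldr max 0 + 1 else τ.foldr max 0

lemma typeNumber_node {α : Type} (x : α) (ts : List (PlaneTree α)) :
    (PlaneTree.node x ts).typeNumber = typeOf (ts.map PlaneTree.typeNumber) := by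
  rw [PlaneTree.typeNumber]
  simp [typeOf]

lemma expand_append (l l' : List ℤ) : expand (l ++ l') = expand l ++ expand l' := by
  simp [expand]

lemma expand_cons_of_nonneg {d : ℤ} (hd : 0 ≤ d) (l : List ℤ) :
    expand (d :: l) = some d :: expand l := by
  simp [expand, not_lt.mpr hd]

lemma expand_neg {h : ℕ} (hh : 1 ≤ h) :
    expand [-(h : ℤ)] = List.replicate h none ++ [some (-(h : ℤ))] := by
  simp [expand, show 0 < h by omega]

lemma expand_replicate_zero (n : ℕ) : expand (List.replicate n 0) = List.replicate n (some 0) := by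
  induction n with
  | zero => rfl
  | succ n ih => rw [List.replicate_succ, expand_cons_of_nonneg le_rfl, ih, List.replicate_succ]

lemma reduceOption_expand (l : List ℤ) : (expand l).reduceOption = l := by
  induction l with
  | nil => rfl
  | cons d l ih =>
    rw [← List.singleton_append, expand_append, List.reduceOption_append, ih]
    congr 1
    by_cases hd : d < 0 <;> simp [expand, hd, List.reduceOption_append]

/-- The steps of the walk of a word of labels. -/
def steps (w : List (Option ℤ)) : List ℤ := w.map fun x => (arity x : ℤ) - 1

lemma steps_append (w w' : List (Option ℤ)) : steps (w ++ w') = steps w ++ steps w' := by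
  simp [steps]

lemma steps_replicate_none (n : ℕ) : steps (List.replicate n none) = List.replicate n (-1) := by
  simp [steps, arity]

/-- Expansion replaces a drop by `h + 1` with `h + 1` unit drops. These stay positive before each
step because the height after the drop is either positive, being followed by another letter, or
equal to `e ≥ 0`. -/
lemma path_steps_expand {q e : ℤ} (he : 0 ≤ e) {l : List ℤ} (h : WordPath q l e) :
    Path q (steps (expand l)) e := by
  induction l generalizing q with
  | nil => exact h
  | cons d l ih =>
    rw [← List.singleton_append, expand_append, steps_append]
    refine Path.append (c := q + (d - 1)) ?_ (ih h.2)
    have hq := h.1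
    have hq' : 0 ≤ q + (d - 1) := by
      cases l with
      | nil => exact (show q + (d - 1) = e from h.2) ▸ he
      | cons y l => exact h.2.1.le
    by_cases hd : d < 0
    · obtain ⟨n, rfl⟩ : ∃ n : ℕ, d = -n := ⟨d.natAbs, by omega⟩
      rw [expand_neg (by omega), steps_append, steps_replicate_none]
      refine Path.append (c := q - n) ?_ ?_
      · have := path_replicate n (q - n) (by omega)
        rwa [add_sub_cancel] at this
      · simp only [steps, arity, Path, List.map]
        omega
    · rw [expand_cons_of_nonneg (by omega)]
      simp only [steps, arity, Path, List.map, expand, List.flatMap_nil]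
      omega

lemma flatMap_preorder_parse (w : List (Option ℤ)) : (parse w).flatMap PlaneTree.preorder = w := by
  induction w with
  | nil => rfl
  | cons x w ih =>
    rw [parse, List.flatMap_cons, preorder_node, List.cons_append, ← List.flatMap_append,
      List.take_append_drop, ih]

lemma length_parse {q : ℕ} {w : List (Option ℤ)} (h : Path q (steps w) 0) :
    (parse w).length = q := by
  induction w generalizing q with
  | nil => exact_mod_cast (show (q : ℤ) = 0 from h).symm
  | cons x w ih =>
    have h1 : (0 : ℤ) < q := h.1
    have h2 : Path (q + ((arity x : ℤ) - 1)) (steps w) 0 := h.2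
    have := ih (q := q - 1 + arity x) (by convert h2 using 1; omega)
    rw [parse, List.length_cons, List.length_drop, this]
    omega

/-- A walk down to `0` leaves no vertex of `w` short of children, so nothing in `w'` is attached to
it. -/
lemma parse_append {q : ℕ} {w : List (Option ℤ)} (h : Path q (steps w) 0) (w' : List (Option ℤ)) :
    parse (w ++ w') = parse w ++ parse w' := by
  induction w generalizing q with
  | nil => rfl
  | cons x w ih =>
    have h1 : (0 : ℤ) < q := h.1
    have h2 : Path (q + ((arity x : ℤ) - 1)) (steps w) 0 := h.2
    have h3 : Path ((q - 1 + arity x : ℕ) : ℤ) (steps w) 0 := by convert h2 using 1; omega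
    have h4 := length_parse h3
    rw [List.cons_append, parse, ih h3, parse, List.take_append_of_le_length (by omega),
      List.drop_append_of_le_length (by omega), List.cons_append]

/-- Only arities enter the shape of the forest; hence turning canceled leaves back into zeros
changes no type. -/
lemma map_typeNumber_parse_congr {w w' : List (Option ℤ)} (h : w.map arity = w'.map arity) :
    (parse w).map PlaneTree.typeNumber = (parse w').map PlaneTree.typeNumber := by
  induction w generalizing w' with
  | nil =>
    obtain rfl : w' = [] := by simpa using h.symm
    rfl
  | cons x w ih =>
    cases w' with
    | nil => simp at h
    | cons x' w' =>
      simp only [List.map_cons, List.cons.injEq] at h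
      simp only [parse, List.map_cons, typeNumber_node, List.map_take, List.map_drop, ih h.2, h.1]

lemma parse_cons_of_arity_eq_zero {x : Option ℤ} (hx : arity x = 0) (w : List (Option ℤ)) :
    parse (x :: w) = .node x [] :: parse w := by
  simp [parse, hx]

/-- The word of a root-containing subtree whose last `r` leaves are canceled from outside. -/
lemma parse_expand_append_replicate {d : ℕ} (hd : 2 ≤ d) {l : List ℤ} {r : ℕ}
    (h : WordPath 1 ((d : ℤ) :: l) r) :
    (parse (expand ((d : ℤ) :: l) ++ List.replicate r none)).map
      (fun τ => (restore τ, τ.typeNumber)) =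
      [((d : ℤ) :: l ++ List.replicate r 0, typeNumber ((d : ℤ) :: l ++ List.replicate r 0))] := by
  set t : List ℤ := (d : ℤ) :: l with ht
  have hpath : Path ((1 : ℕ) : ℤ) (steps (expand t ++ List.replicate r none)) 0 := by
    rw [steps_append, steps_replicate_none]
    exact (path_steps_expand (by positivity) h).append (by simpa using path_replicate r 0 le_rfl)
  have hlen : (parse (expand l ++ List.replicate r none)).length = d := by
    rw [ht, expand_cons_of_nonneg (by positivity), List.cons_append] at hpath
    refine length_parse ?_
    convert hpath.2 using 1
    · simp [arity]
    · rfl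
  have hparse : parse (expand t ++ List.replicate r none) =
      [.node (some d) (parse (expand l ++ List.replicate r none))] := by
    rw [ht, expand_cons_of_nonneg (by positivity), List.cons_append, parse,
      List.take_of_length_le (by simp [arity, hlen]), List.drop_of_length_le (by simp [arity, hlen])]
  have htype : (parse (expand t ++ List.replicate r none)).map PlaneTree.typeNumber =
      (parse (expand (t ++ List.replicate r 0))).map PlaneTree.typeNumber := by
    refine map_typeNumber_parse_congr ?_
    simp [expand_append, expand_replicate_zero, arity]
  -- The expansion of `t` ends in a vertex that is not canceled, so the trailing canceled vertices
  -- seen by `restore` are exactly the `r` appended ones.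
  have hlast : ∃ w y, expand t = w ++ [some y] := by
    obtain ⟨s, y, hs⟩ : ∃ s y, t = s ++ [y] :=
      ⟨_, _, (List.dropLast_append_getLast (by simp [ht])).symm⟩
    rw [hs, expand_append]
    by_cases hy : y < 0
    · exact ⟨expand s ++ List.replicate y.natAbs none, y, by simp [expand, hy]⟩
    · exact ⟨expand s, y, by simp [expand, hy]⟩
  have hpre : (PlaneTree.node (some (d : ℤ)) (parse (expand l ++ List.replicate r none))).preorder =
      expand t ++ List.replicate r none := by
    have := flatMap_preorder_parse (expand t ++ List.replicate r none)
    rwa [hparse, List.flatMap_singleton] at this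
  have hrestore : restore (.node (some (d : ℤ)) (parse (expand l ++ List.replicate r none))) =
      t ++ List.replicate r 0 := by
    obtain ⟨τ, τs, hτ⟩ : ∃ τ τs, parse (expand l ++ List.replicate r none) = τ :: τs :=
      List.exists_cons_of_length_pos (by omega)
    rw [hτ] at hpre ⊢
    rw [restore, hpre]
    obtain ⟨w, y, hw⟩ := hlast
    congr 1
    · simp [List.reduceOption_append, reduceOption_expand]
    · rw [hw, List.rtakeWhile]
      simp
  rw [hparse] at htype ⊢
  simp only [List.map_cons, List.map_nil] at htype ⊢
  rw [hrestore, typeNumber, toTree]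
  congr 2
  cases hp : parse (expand (t ++ List.replicate r 0)) with
  | nil => simp [hp] at htype
  | cons τ τs =>
    rw [hp] at htype
    simp only [List.map_cons, List.cons.injEq] at htype
    exact htype.1

lemma toTree_cons {d : ℕ} {l : List ℤ} (h : WordPath d l 0) :
    toTree ((d : ℤ) :: l) = .node (some d) (parse (expand l)) := by
  have h1 := length_parse (path_steps_expand le_rfl h)
  rw [toTree, expand_cons_of_nonneg (by positivity), parse, List.headD_cons,
    List.take_of_length_le (by simp [arity, h1])]

lemma typeNumber_T0 : typeNumber T0 = 0 := by
  simp [typeNumber, toTree, T0, expand, parse, typeNumber_node, typeOf]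

/-- A leaf, canceled or not. -/
lemma map_parse_cons_leaf {x : Option ℤ} (hx : arity x = 0) (w : List (Option ℤ)) :
    (parse (x :: w)).map (fun τ => (restore τ, τ.typeNumber)) =
      (T0, typeNumber T0) :: (parse w).map (fun τ => (restore τ, τ.typeNumber)) := by
  rw [parse_cons_of_arity_eq_zero hx, List.map_cons, typeNumber_T0]
  simp [restore, typeNumber_node, typeOf]

lemma map_parse_replicate_none (n : ℕ) (w : List (Option ℤ)) :
    (parse (List.replicate n none ++ w)).map (fun τ => (restore τ, τ.typeNumber)) =
      List.replicate n (T0, typeNumber T0) ++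
        (parse w).map (fun τ => (restore τ, τ.typeNumber)) := by
  induction n with
  | zero => rfl
  | succ n ih =>
    rw [List.replicate_succ, List.cons_append, map_parse_cons_leaf rfl, ih, List.replicate_succ,
      List.cons_append]

/-! ### Terminal zeros -/

@[simp] lemma terminal_nil : terminal [] = 0 := rfl

lemma terminal_concat_zero (l : List ℤ) : terminal (l ++ [0]) = terminal l + 1 := by
  simp [terminal, List.rtakeWhile]

lemma terminal_concat_of_ne {x : ℤ} (hx : x ≠ 0) (l : List ℤ) : terminal (l ++ [x]) = 0 := by
  simp [terminal, List.rtakeWhile, hx]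

lemma terminal_append_replicate (l : List ℤ) (r : ℕ) :
    terminal (l ++ List.replicate r 0) = terminal l + r := by
  induction r with
  | zero => simp
  | succ r ih => rw [List.replicate_succ', ← List.append_assoc, terminal_concat_zero, ih]; rfl

lemma terminal_append_cons {x : ℤ} (hx : x ≠ 0) (l l' : List ℤ) :
    terminal (l ++ x :: l') = terminal (x :: l') := by
  induction l' using List.reverseRecOn with
  | nil => rw [terminal_concat_of_ne hx, ← List.nil_append [x], terminal_concat_of_ne hx]
  | append_singleton l' y ih =>
    rw [← List.cons_append, ← List.append_assoc]
    by_cases hy : y = 0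
    · rw [hy, terminal_concat_zero, terminal_concat_zero, ih]
    · rw [terminal_concat_of_ne hy, terminal_concat_of_ne hy]

lemma exists_eq_append_replicate {r : ℕ} {l : List ℤ} (h : r ≤ terminal l) :
    ∃ s, l = s ++ List.replicate r 0 := by
  induction r generalizing l with
  | zero => exact ⟨l, by simp⟩
  | succ r ih =>
    rcases List.eq_nil_or_concat l with rfl | ⟨l, x, rfl⟩
    · simp at h
    · by_cases hx : x = 0
      · subst hx
        rw [List.concat_eq_append, terminal_concat_zero] at h
        obtain ⟨s, rfl⟩ := ih (Nat.le_of_succ_le_succ h)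
        exact ⟨s, by rw [List.concat_eq_append, List.replicate_succ', List.append_assoc]⟩
      · rw [List.concat_eq_append, terminal_concat_of_ne hx] at h
        omega

lemma terminal_lt_length {d : ℤ} (hd : d ≠ 0) (l : List ℤ) :
    terminal (d :: l) < (d :: l).length := by
  induction l using List.reverseRecOn with
  | nil => rw [← List.nil_append [d], terminal_concat_of_ne hd]; simp
  | append_singleton l y ih =>
    rw [← List.cons_append]
    by_cases hy : y = 0
    · rw [hy, terminal_concat_zero]
      simpa using ih
    · rw [terminal_concat_of_ne hy]
      simp

lemma mem_lukPart_iff {m i : ℕ} (hi : i < m) {l : List ℤ} :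
    l ∈ LukPart m i ↔ l ∈ Luk m ∧ l ≠ T0 ∧ min (m - 1) (terminal l) = i := by
  simp only [LukPart, Set.mem_ofPred_eq]
  refine and_congr_right fun _ => and_congr_right fun _ => ?_
  split_ifs <;> omega

/-! ### Blocks and sequences of blocks -/

variable {m : ℕ}

/-- The trees that may be the first tree of a block with the given data. -/
def ValidBlock : PartialBlock m → List ℤ → Prop
  | .one i, t => t ∈ LukPart m i
  | .oneT0, t => t = T0
  | .triple i _ _ _ _ _ _ _, t => t ∈ LukPart m i
  | .tripleT0 _ _ _, t => t = T0

/-- The part of the word of a tree that is described by a block with first tree `t`. -/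
def blockWord : PartialBlock m → List ℤ → List ℤ
  | .one _, t => t
  | .oneT0, t => t
  | .triple _ k h _ _ _ _ _, t => t.take (t.length - (h + 2 - k)) ++ [-(h : ℤ)]
  | .tripleT0 k _ _, _ => [-((k - 1 : ℕ) : ℤ)]

/-- A partial tree together with the first trees of its blocks. -/
abbrev BlockSeq (m : ℕ) : Type := List (PartialBlock m × List ℤ)

/-- The first tree of every block is admissible. -/
def ValidSeq (ω : BlockSeq m) : Prop := ∀ x ∈ ω, ValidBlock x.1 x.2

/-- The underlying partial tree. -/
abbrev shape (ω : BlockSeq m) : PartialTree m := ω.map Prod.fst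

/-- The word of the sequence of root subtrees. -/
def forestWord (ω : BlockSeq m) : List ℤ := ω.flatMap fun x => blockWord x.1 x.2

/-- The word of the tree that is described by a sequence of blocks. -/
def treeWord (ω : BlockSeq m) : List ℤ :=
  ((PartialTree.rootDegree (shape ω) : ℕ) : ℤ) :: forestWord ω

lemma exists_of_mem_lukPart {i : ℕ} {t : List ℤ} (ht : t ∈ LukPart m i) :
    ∃ d : ℕ, 2 ≤ d ∧ ∃ l, t = (d : ℤ) :: l ∧ WordPath d l 0 :=
  exists_cons_of_mem_luk ht.1 ht.2.1

lemma le_terminal_of_mem_lukPart {i : Fin m} {t : List ℤ} (ht : t ∈ LukPart m i) :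
    (i : ℕ) ≤ terminal t := by
  have := ((mem_lukPart_iff i.2).mp ht).2.2
  omega

/-- Removing `r` zeros at the end of a tree. -/
lemma exists_trim {i : Fin m} {t : List ℤ} (ht : t ∈ LukPart m i) {r : ℕ} (hr : r ≤ i) :
    ∃ d : ℕ, 2 ≤ d ∧ ∃ l, t = (d : ℤ) :: l ++ List.replicate r 0 ∧
      t.take (t.length - r) = (d : ℤ) :: l ∧ WordPath 1 ((d : ℤ) :: l) r := by
  obtain ⟨s, hs⟩ := exists_eq_append_replicate (hr.trans (le_terminal_of_mem_lukPart ht))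
  obtain ⟨d, hd, l', hl', -⟩ := exists_of_mem_lukPart ht
  cases s with
  | nil =>
    rw [hl'] at hs
    cases r with
    | zero => simp at hs
    | succ r =>
      simp only [List.nil_append, List.replicate_succ, List.cons.injEq] at hs
      omega
  | cons y s =>
    have hy : y = d := by
      rw [hl'] at hs
      simp only [List.cons_append, List.cons.injEq] at hs
      exact hs.1.symm
    subst hy
    refine ⟨d, hd, s, hs, by rw [hs]; exact List.take_left' (by simp; omega), ?_⟩
    have hp := (mem_luk_iff.mp ht.1).2
    rw [hs, wordPath_append] at hp
    obtain ⟨c, h1, h2⟩ := hp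
    have h3 := h2.eq_add_sum
    simp only [List.map_replicate, zero_sub, List.sum_replicate, smul_neg, nsmul_eq_mul,
      mul_one] at h3
    obtain rfl : c = r := by omega
    exact h1

lemma PartialBlock.length_pos (b : PartialBlock m) : 1 ≤ b.length := by
  cases b <;> simp only [PartialBlock.length] <;> omega

/-- The length of a block is its drop. For a triple, the trimmed first tree ends at height `h + 2 -
k > 0`, and the letter `-h` then leads to `1 - k`. -/
lemma ValidBlock.path {b : PartialBlock m} {t : List ℤ} (h : ValidBlock b t) :
    WordPath 1 (blockWord b t) (1 - b.length) := by
  cases b with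
  | one i => simpa [PartialBlock.length, blockWord] using (mem_luk_iff.mp h.1).2
  | oneT0 =>
    obtain rfl : t = T0 := h
    simp [PartialBlock.length, blockWord, T0, WordPath, Path]
  | triple i k h' h1 h2 h3 h4 h5 =>
    obtain ⟨d, hd, l, -, ht, hp⟩ := exists_trim (i := i) h (r := h' + 2 - k) (by omega)
    rw [blockWord, ht, wordPath_append]
    refine ⟨_, hp, ?_⟩
    simp only [WordPath, Path, List.map, PartialBlock.length]
    omega
  | tripleT0 k h1 h2 =>
    simp only [WordPath, Path, List.map, PartialBlock.length, blockWord]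
    omega

lemma ValidBlock.letters (hm : 1 ≤ m) {b : PartialBlock m} {t : List ℤ} (h : ValidBlock b t) :
    Letters m (blockWord b t) := by
  cases b with
  | one i => exact (mem_luk_iff.mp h.1).1
  | oneT0 =>
    obtain rfl : t = T0 := h
    exact (mem_luk_iff.mp (T0_mem_luk hm)).1
  | triple i k h' h1 h2 h3 h4 h5 =>
    obtain ⟨d, hd, l, hl, ht, hp⟩ := exists_trim (i := i) h (r := h' + 2 - k) (by omega)
    have h6 := (mem_luk_iff.mp h.1).1
    rw [hl, letters_append] at h6
    rw [blockWord, ht, letters_append]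
    refine ⟨h6.1, ?_⟩
    simp only [Letters, List.mem_singleton, forall_eq]
    omega
  | tripleT0 k h1 h2 =>
    simp only [Letters, List.mem_singleton, forall_eq, blockWord]
    omega

lemma rootDegree_cons (x : PartialBlock m) (T : PartialTree m) :
    PartialTree.rootDegree (x :: T) = x.length + PartialTree.rootDegree T := by
  simp [PartialTree.rootDegree]

lemma forestWord_cons (x : PartialBlock m × List ℤ) (ω : BlockSeq m) :
    forestWord (x :: ω) = blockWord x.1 x.2 ++ forestWord ω := rfl

lemma ValidSeq.path {ω : BlockSeq m} (h : ValidSeq ω) :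
    WordPath (PartialTree.rootDegree (shape ω)) (forestWord ω) 0 := by
  induction ω with
  | nil => rfl
  | cons x ω ih =>
    rw [shape, List.map_cons, rootDegree_cons, forestWord_cons, wordPath_append]
    refine ⟨_, ?_, ih fun y hy => h y (List.mem_cons_of_mem _ hy)⟩
    have h2 := x.1.length_pos
    -- The walk of the first block, from `1` to `1 - length`, is raised so that it ends where the
    -- remaining blocks begin.
    exact (h x List.mem_cons_self).path.add (c := x.1.length + PartialTree.rootDegree (shape ω) - 1)
      (by omega) (by push_cast; ring) (by ring)

lemma ValidSeq.letters (hm : 1 ≤ m) {ω : BlockSeq m} (h : ValidSeq ω) :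
    Letters m (forestWord ω) := by
  intro d hd
  obtain ⟨x, hx, hd⟩ := List.mem_flatMap.mp hd
  exact (h x hx).letters hm d hd

/-! ### The tree of a sequence of blocks -/

/-- The root subtrees that are described by a block with first tree `t`. -/
def blockSubtrees (b : PartialBlock m) (t : List ℤ) : List (List ℤ) :=
  t :: List.replicate (b.length - 1) T0

/-- In a triple, the first `h + 2 - k` of the `h` canceled leaves complete the first tree; the other
`k - 2` and the leaf of degree `-h` are root subtrees `T0`. Words and types are paired because the
type of a subtree inside the big tree must match that of its restored word. -/
lemma ValidBlock.parse {b : PartialBlock m} {t : List ℤ} (h : ValidBlock b t) :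
    (parse (expand (blockWord b t))).map (fun τ => (restore τ, τ.typeNumber)) =
      (blockSubtrees b t).map fun t => (t, typeNumber t) := by
  cases b with
  | one i =>
    obtain ⟨d, hd, l, rfl, -⟩ := exists_of_mem_lukPart h
    have := parse_expand_append_replicate hd (r := 0) (mem_luk_iff.mp h.1).2
    simpa [blockSubtrees, PartialBlock.length, blockWord] using this
  | oneT0 =>
    obtain rfl : t = T0 := h
    rw [blockWord, T0, expand_cons_of_nonneg le_rfl, map_parse_cons_leaf rfl]
    rfl
  | triple i k h' h1 h2 h3 h4 h5 =>
    obtain ⟨d, hd, l, hl, ht, hp⟩ := exists_trim (i := i) h (r := h' + 2 - k) (by omega)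
    have h6 : List.replicate h' (none : Option ℤ) =
        List.replicate (h' + 2 - k) none ++ List.replicate (k - 2) none := by
      rw [← List.replicate_add]
      congr 1
      omega
    have h7 : Path ((1 : ℕ) : ℤ)
        (steps (expand ((d : ℤ) :: l) ++ List.replicate (h' + 2 - k) none)) 0 := by
      rw [steps_append, steps_replicate_none]
      exact (path_steps_expand (by positivity) hp).append
        (by simpa using path_replicate (h' + 2 - k) 0 le_rfl)
    rw [blockWord, ht, expand_append, expand_neg h1, h6, List.append_assoc, ← List.append_assoc,
      parse_append h7, List.map_append, parse_expand_append_replicate hd hp,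
      map_parse_replicate_none, map_parse_cons_leaf (by simp [arity]), ← hl]
    simp only [blockSubtrees, PartialBlock.length, List.map_cons, List.map_replicate]
    obtain ⟨j, rfl⟩ : ∃ j, k = j + 2 := ⟨k - 2, by omega⟩
    simp [NRS.parse, List.replicate_succ']
  | tripleT0 k h1 h2 =>
    obtain rfl : t = T0 := h
    obtain ⟨j, rfl⟩ : ∃ j, k = j + 2 := ⟨k - 2, by omega⟩
    rw [blockWord, expand_neg (by omega), map_parse_replicate_none,
      map_parse_cons_leaf (by simp [arity]), NRS.parse, List.map_nil]
    simp only [blockSubtrees, PartialBlock.length, List.map_cons, List.map_replicate,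
      show j + 2 - 1 = j + 1 by omega]
    rw [← List.replicate_succ, ← List.replicate_succ']

lemma ValidSeq.parse {ω : BlockSeq m} (h : ValidSeq ω) :
    (parse (expand (forestWord ω))).map (fun τ => (restore τ, τ.typeNumber)) =
      (ω.flatMap fun x => blockSubtrees x.1 x.2).map fun t => (t, typeNumber t) := by
  induction ω with
  | nil => rfl
  | cons x ω ih =>
    have hx := h x List.mem_cons_self
    have hp : Path (x.1.length : ℤ) (steps (expand (blockWord x.1 x.2))) 0 := by
      refine path_steps_expand le_rfl ?_
      have h2 := x.1.length_pos
      exact hx.path.add (c := x.1.length - 1) (by omega) (by ring) (by ring)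
    rw [forestWord_cons, expand_append, parse_append hp, List.map_append, hx.parse,
      ih fun y hy => h y (List.mem_cons_of_mem _ hy), List.flatMap_cons, List.map_append]

lemma ValidSeq.rootSubtrees {ω : BlockSeq m} (h : ValidSeq ω) :
    rootSubtrees (treeWord ω) = ω.flatMap fun x => blockSubtrees x.1 x.2 := by
  have := congrArg (List.map Prod.fst) h.parse
  rw [NRS.rootSubtrees, treeWord, toTree_cons h.path]
  simpa [Function.comp_def, PlaneTree.children] using this

lemma ValidSeq.typeNumber {ω : BlockSeq m} (h : ValidSeq ω) :
    typeNumber (treeWord ω) = typeOf ((NRS.rootSubtrees (treeWord ω)).map NRS.typeNumber) := by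
  have := congrArg (List.map Prod.snd) h.parse
  rw [h.rootSubtrees, NRS.typeNumber, treeWord, toTree_cons h.path, typeNumber_node]
  congr 1
  simpa [Function.comp_def] using this

/-- From right to left, a `T0` adds one zero, a tree stops the count because its first letter is
nonzero, and a negative last letter gives none. The cap at `m - 1` is compatible with adding zeros.
-/
lemma ValidSeq.terminal {ω : BlockSeq m} (h : ValidSeq ω)
    (hω : 2 ≤ PartialTree.rootDegree (shape ω)) :
    min (m - 1) (terminal (treeWord ω)) = PartialTree.terminal (shape ω) := by
  rw [treeWord, PartialTree.terminal]
  -- The root letter has to stay fixed while blocks are removed on the right; it only matters that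
  -- it is nonzero.
  generalize PartialTree.rootDegree (shape ω) = D at hω
  induction ω using List.reverseRecOn with
  | nil =>
    rw [show forestWord ([] : BlockSeq m) = [] from rfl, ← List.nil_append [(D : ℤ)],
      terminal_concat_of_ne (by omega)]
    rfl
  | append_singleton ω x ih =>
    obtain ⟨b, t⟩ := x
    have hb : ValidBlock b t := h (b, t) (by simp)
    have hω' : forestWord (ω ++ [(b, t)]) = forestWord ω ++ blockWord b t := by simp [forestWord]
    rw [hω', shape, List.map_append, List.map_singleton, List.reverse_append,
      List.reverse_singleton, List.singleton_append, ← List.cons_append]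
    cases b with
    | one i =>
      obtain ⟨d, hd, l, hl, -⟩ := exists_of_mem_lukPart hb
      have h2 := ((mem_lukPart_iff i.2).mp hb).2.2
      rw [blockWord, terminalAux]
      rw [hl] at h2 ⊢
      rw [terminal_append_cons (by omega), h2]
      omega
    | oneT0 =>
      obtain rfl : t = T0 := hb
      rw [blockWord, T0, terminal_concat_zero, terminalAux]
      have := ih fun y hy => h y (List.mem_append_left _ hy)
      rw [shape] at this
      omega
    | triple i k h' h1 h2 h3 h4 h5 =>
      rw [blockWord, ← List.append_assoc, terminal_concat_of_ne (by omega)]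
      rfl
    | tripleT0 k h1 h2 =>
      rw [blockWord, terminal_concat_of_ne (by omega)]
      rfl

lemma ValidSeq.mem_luk (hm : 1 ≤ m) {ω : BlockSeq m} (h : ValidSeq ω)
    (hω : 2 ≤ PartialTree.rootDegree (shape ω)) : treeWord ω ∈ Luk m ∧ treeWord ω ≠ T0 := by
  constructor
  · rw [mem_luk_iff, treeWord, letters_cons, wordPath_cons, add_sub_cancel]
    exact ⟨⟨by omega, h.letters hm⟩, one_pos, h.path⟩
  · rw [treeWord, T0, Ne, List.cons.injEq]
    omega

lemma ValidSeq.mem_lukPart_iff (hm : 1 ≤ m) {ω : BlockSeq m} (h : ValidSeq ω)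
    (hω : 2 ≤ PartialTree.rootDegree (shape ω)) {i : Fin m} :
    treeWord ω ∈ LukPart m i ↔ PartialTree.terminal (shape ω) = i := by
  rw [NRS.mem_lukPart_iff i.2, h.terminal hω]
  have := h.mem_luk hm hω
  tauto

/-! ### Every tree is described by exactly one sequence of blocks -/

lemma lukPart_unique {i j : Fin m} {t : List ℤ} (hi : t ∈ LukPart m i) (hj : t ∈ LukPart m j) :
    i = j := by
  have h1 := ((mem_lukPart_iff i.2).mp hi).2.2
  have h2 := ((mem_lukPart_iff j.2).mp hj).2.2
  exact Fin.ext (h1.symm.trans h2)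

lemma ValidBlock.blockWord_cases {b : PartialBlock m} {t : List ℤ} (h : ValidBlock b t) :
    ∃ y l, blockWord b t = y :: l := by
  cases b with
  | one i =>
    obtain ⟨d, hd, l, hl, -⟩ := exists_of_mem_lukPart h
    exact ⟨d, l, hl⟩
  | oneT0 => exact ⟨0, [], h⟩
  | triple i k h' h1 h2 h3 h4 h5 =>
    obtain ⟨d, hd, l, hl, ht, hp⟩ := exists_trim (i := i) h (r := h' + 2 - k) (by omega)
    exact ⟨d, l ++ [-(h' : ℤ)], by rw [blockWord, ht]; rfl⟩
  | tripleT0 k h1 h2 => exact ⟨_, [], rfl⟩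

/-- The sign of the first letter tells blocks that begin with `T0` from the others. -/
lemma ValidBlock.two_le_headD {b : PartialBlock m} {t : List ℤ} (h : ValidBlock b t) :
    2 ≤ (blockWord b t).headD 0 ↔ t ≠ T0 := by
  cases b with
  | one i =>
    obtain ⟨d, hd, l, hl, -⟩ := exists_of_mem_lukPart h
    simp only [h.2.1, ne_eq, not_false_eq_true, iff_true, blockWord]
    rw [hl]
    simpa using hd
  | oneT0 =>
    obtain rfl : t = T0 := h
    simp [blockWord, T0]
  | triple i k h' h1 h2 h3 h4 h5 =>
    obtain ⟨d, hd, l, hl, ht, hp⟩ := exists_trim (i := i) h (r := h' + 2 - k) (by omega)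
    simp only [h.2.1, ne_eq, not_false_eq_true, iff_true, blockWord, ht]
    simpa using hd
  | tripleT0 k h1 h2 =>
    obtain rfl : t = T0 := h
    simp only [ne_eq, not_true_eq_false, iff_false, blockWord, List.headD_cons]
    omega

/-- The drop gives the length, the first letter tells whether the first tree is `T0`, and the last
letter of a triple gives `h`. Then the number `h + 2 - k` of removed zeros is known and the first
tree can be recovered. -/
lemma ValidBlock.injective {b b' : PartialBlock m} {t t' : List ℤ} (h : ValidBlock b t)
    (h' : ValidBlock b' t') (heq : blockWord b t = blockWord b' t') : (b, t) = (b', t') := by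
  have hlen : b.length = b'.length := by
    have h1 := h.path.eq_add_sum
    have h2 := h'.path.eq_add_sum
    rw [heq] at h1
    omega
  have hT0 : t ≠ T0 ↔ t' ≠ T0 := by rw [← h.two_le_headD, ← h'.two_le_headD, heq]
  cases b with
  | one i =>
    cases b' with
    | one i' =>
      obtain rfl : t = t' := heq
      obtain rfl := lukPart_unique h h'
      rfl
    | oneT0 => exact absurd h' (hT0.mp h.2.1)
    | triple => simp only [PartialBlock.length] at hlen; omega
    | tripleT0 => exact absurd h' (hT0.mp h.2.1)
  | oneT0 =>
    obtain rfl : t = T0 := h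
    obtain rfl : t' = T0 := by simpa using hT0
    cases b' with
    | one i' => exact absurd rfl h'.2.1
    | oneT0 => rfl
    | triple => exact absurd rfl h'.2.1
    | tripleT0 => simp only [PartialBlock.length] at hlen; omega
  | triple i k j h1 h2 h3 h4 h5 =>
    cases b' with
    | one i' => simp only [PartialBlock.length] at hlen; omega
    | oneT0 => exact absurd h' (hT0.mp h.2.1)
    | triple i' k' j' h1' h2' h3' h4' h5' =>
      obtain rfl : k = k' := hlen
      obtain ⟨d, hd, l, hl, ht, -⟩ := exists_trim (i := i) h (r := j + 2 - k) (by omega)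
      obtain ⟨d', hd', l', hl', ht', -⟩ := exists_trim (i := i') h' (r := j' + 2 - k) (by omega)
      rw [blockWord, blockWord, ht, ht'] at heq
      obtain ⟨h6, h7⟩ := List.append_inj' heq rfl
      obtain rfl : j = j' := by simpa using h7
      obtain rfl : t = t' := by rw [hl, hl', h6]
      obtain rfl := lukPart_unique h h'
      rfl
    | tripleT0 => exact absurd h' (hT0.mp h.2.1)
  | tripleT0 k h1 h2 =>
    obtain rfl : t = T0 := h
    obtain rfl : t' = T0 := by simpa using hT0
    cases b' with
    | one i' => exact absurd rfl h'.2.1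
    | oneT0 => simp only [PartialBlock.length] at hlen; omega
    | triple => exact absurd rfl h'.2.1
    | tripleT0 k' =>
      obtain rfl : k = k' := hlen
      rfl

lemma forestWord_injective {ω ω' : BlockSeq m} (h : ValidSeq ω) (h' : ValidSeq ω')
    (heq : forestWord ω = forestWord ω') : ω = ω' := by
  induction ω generalizing ω' with
  | nil =>
    cases ω' with
    | nil => rfl
    | cons x ω' =>
      obtain ⟨y, l, hy⟩ := (h' x List.mem_cons_self).blockWord_cases
      rw [forestWord_cons, hy] at heq
      simp [forestWord] at heq
  | cons x ω ih =>
    cases ω' with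
    | nil =>
      obtain ⟨y, l, hy⟩ := (h x List.mem_cons_self).blockWord_cases
      rw [forestWord_cons, hy] at heq
      simp [forestWord] at heq
    | cons x' ω' =>
      have hx := h x List.mem_cons_self
      have hx' := h' x' List.mem_cons_self
      rw [forestWord_cons, forestWord_cons] at heq
      -- Both first blocks end at the first passage of the same walk, hence at the same place.
      have hlen := Path.prefix_unique hx.path (by have := x.1.length_pos; omega) hx'.path
        (by have := x'.1.length_pos; omega)
        (l := (forestWord ω).map fun d => d - 1) (l' := (forestWord ω').map fun d => d - 1)
        (by rw [← List.map_append, ← List.map_append, heq])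
      simp only [List.length_map] at hlen
      obtain ⟨h1, h2⟩ := List.append_inj heq hlen
      rw [show x = x' from hx.injective hx' h1, ih (fun y hy => h y (List.mem_cons_of_mem _ hy))
        (fun y hy => h' y (List.mem_cons_of_mem _ hy)) h2]

/-- The first block of a word. -/
lemma exists_first_block {d : ℕ} (hd : 1 ≤ d) {l : List ℤ} (hl : Letters m l)
    (h : WordPath d l 0) : ∃ b t l', ValidBlock (m := m) b t ∧ l = blockWord b t ++ l' ∧
      b.length ≤ d ∧ WordPath (d - b.length : ℕ) l' 0 := by
  -- The block ends when the height, initially `d`, is first at most `d - 1`.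
  obtain ⟨p, l', e, hpl, he, hp, hl'⟩ := Path.exists_first_passage (c := (d : ℤ) - 1) (q := 1)
    (by omega) (by rw [sub_add_cancel]; exact h)
  obtain ⟨s, l', rfl, rfl, rfl⟩ := List.map_eq_append_iff.mp hpl
  have hle : 0 ≤ (d : ℤ) - 1 + e := by
    cases l' with
    | nil => exact (show (d : ℤ) - 1 + e = 0 from hl').ge
    | cons y l' => exact hl'.1.le
  rw [letters_append] at hl
  suffices H : ∃ b t, ValidBlock (m := m) b t ∧ s = blockWord b t ∧ e = 1 - b.length by
    obtain ⟨b, t, hb, rfl, rfl⟩ := H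
    refine ⟨b, t, l', hb, rfl, by omega, ?_⟩
    have h1 : ((d - b.length : ℕ) : ℤ) = (d : ℤ) - 1 + (1 - b.length) := by omega
    rw [h1]
    exact hl'
  obtain ⟨hs, -⟩ := hl
  rcases List.eq_nil_or_concat s with rfl | ⟨s, y, rfl⟩
  · have : (1 : ℤ) = e := hp
    omega
  rw [List.concat_eq_append] at *
  have hp' : WordPath 1 (s ++ [y]) e := hp
  rw [wordPath_append] at hp'
  obtain ⟨c, hc, hc0, hc'⟩ := hp'
  have hc' : c + (y - 1) = e := hc'
  obtain ⟨hs1, hy⟩ := letters_append.mp hs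
  have hy : y ≠ 1 ∧ -(m : ℤ) + 1 ≤ y := hy y (by simp)
  -- Here `s` is the block without its last letter; it is empty exactly when the first tree is `T0`.
  cases s with
  | nil =>
    have hc1 : 1 = c := hc
    rcases eq_or_ne y 0 with rfl | hy0
    · exact ⟨.oneT0, T0, rfl, rfl, by simp [PartialBlock.length]; omega⟩
    · refine ⟨.tripleT0 (1 - y).toNat (by omega) (by omega), T0, rfl, ?_, ?_⟩
      · simp only [blockWord, List.nil_append, List.cons.injEq, and_true]
        omega
      · simp only [PartialBlock.length]
        omega
  | cons x s =>
    obtain ⟨hx, hs'⟩ := letters_cons.mp hs1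
    have hx2 : 2 ≤ x := by
      have h1 : Path (1 + (x - 1)) (s.map fun d => d - 1) c := hc.2
      have : 0 < x := by
        cases s with
        | nil => have : 1 + (x - 1) = c := h1; omega
        | cons z s => have := h1.1; omega
      omega
    have mem_part : ∀ t, t ∈ Luk m → t ≠ T0 → ∃ i : Fin m, t ∈ LukPart m i ∧
        min (m - 1) (NRS.terminal t) = i := by
      intro t ht ht0
      have hm : 0 < m := by omega
      refine ⟨⟨min (m - 1) (NRS.terminal t), by omega⟩, ?_, rfl⟩
      exact (mem_lukPart_iff (by omega)).mpr ⟨ht, ht0, rfl⟩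
    rcases eq_or_ne e 0 with rfl | he0
    · obtain ⟨i, hi, -⟩ := mem_part (x :: s ++ [y])
        (mem_luk_iff.mpr ⟨hs, hp⟩)
        (by simp [T0])
      exact ⟨.one i, _, hi, rfl, by simp [PartialBlock.length]⟩
    -- The height `r` before the last letter `-a` is the number of zeros needed to complete the
    -- first tree. The drop `k` forces `r = a + 2 - k ≤ m - 1`, so the capped count `i` is still at
    -- least `r`.
    · obtain ⟨r, rfl⟩ := Int.eq_ofNat_of_zero_le hc0.le
      obtain ⟨a, rfl⟩ : ∃ a : ℕ, y = -(a : ℤ) := ⟨y.natAbs, by omega⟩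
      obtain ⟨k, rfl⟩ : ∃ k : ℕ, e = 1 - (k : ℤ) := ⟨(1 - e).toNat, by omega⟩
      obtain ⟨i, hi, hi'⟩ := mem_part (x :: s ++ List.replicate r 0)
        (mem_luk_iff.mpr ⟨letters_append.mpr ⟨hs1, fun d hd => by
          rw [(List.mem_replicate.mp hd).2]; omega⟩,
          wordPath_append.mpr ⟨r, hc, wordPath_replicate r⟩⟩)
        (by rw [T0, List.cons_append, Ne, List.cons.injEq]; omega)
      rw [terminal_append_replicate] at hi'
      refine ⟨.triple i k a (by omega) (by omega) (by omega) (by omega) (by omega), _, hi, ?_, rfl⟩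
      rw [blockWord, show a + 2 - k = r by omega, List.take_left' (by simp; omega)]

lemma exists_forestWord {d : ℕ} {l : List ℤ} (hl : Letters m l) (h : WordPath d l 0) :
    ∃ ω : BlockSeq m, ValidSeq ω ∧ forestWord ω = l ∧ PartialTree.rootDegree (shape ω) = d := by
  induction d using Nat.strong_induction_on generalizing l with
  | _ d ih =>
    rcases Nat.eq_zero_or_pos d with rfl | hd
    · cases l with
      | nil => exact ⟨[], by simp [ValidSeq], rfl, rfl⟩
      | cons y l => exact absurd h.1 (lt_irrefl _)
    · obtain ⟨b, t, l', hb, rfl, hbd, hl'⟩ := exists_first_block hd hl h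
      obtain ⟨ω, h1, rfl, h3⟩ := ih (d - b.length) (by have := b.length_pos; omega)
        (letters_append.mp hl).2 hl'
      refine ⟨(b, t) :: ω, List.forall_mem_cons.mpr ⟨hb, h1⟩, rfl, ?_⟩
      rw [shape, List.map_cons, rootDegree_cons, h3]
      exact Nat.add_sub_cancel' hbd

/-- The combinatorial core: repeated cutting at first passages gives surjectivity, and the prefix
code property gives injectivity. The root letter carries no further information, as it is the total
length of the blocks. -/
lemma bijOn_treeWord (hm : 1 ≤ m) : Set.BijOn treeWord
    {ω : BlockSeq m | ValidSeq ω ∧ 2 ≤ PartialTree.rootDegree (shape ω)}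
    {l | l ∈ Luk m ∧ l ≠ T0} := by
  refine ⟨fun ω hω => hω.1.mem_luk hm hω.2, fun ω hω ω' hω' heq => ?_, fun l hl => ?_⟩
  · simp only [treeWord, List.cons.injEq] at heq
    exact forestWord_injective hω.1 hω'.1 heq.2
  · obtain ⟨d, hd, l', rfl, h⟩ := exists_cons_of_mem_luk hl.1 hl.2
    obtain ⟨ω, h1, rfl, rfl⟩ := exists_forestWord (letters_cons.mp (mem_luk_iff.mp hl.1).1).2 h
    exact ⟨ω, ⟨h1, hd⟩, rfl⟩

/-! ### Expressions of trees -/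

lemma treeExpr_append (l l' : List ℤ) : treeExpr m (l ++ l') = treeExpr m l * treeExpr m l' := by
  simp [treeExpr]

lemma treeExpr_cons (d : ℤ) (l : List ℤ) :
    treeExpr m (d :: l) = u m ((m : ℤ) + d - 1).toNat * treeExpr m l := by
  simp [treeExpr]

@[simp] lemma treeExpr_nil : treeExpr m [] = 1 := rfl

lemma treeExpr_replicate_zero (hm : 1 ≤ m) (r : ℕ) :
    treeExpr m (List.replicate r 0) = u m (m - 1) ^ r := by
  rw [treeExpr, List.map_replicate, List.prod_replicate]
  congr 2
  omega

/-- Each letter contributes a factor of degree `1`, so the degree of a tree expression is the length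
of the word. -/
lemma exists_treeExpr_eq_single (l : List ℤ) :
    ∃ c : K, treeExpr m l = HahnSeries.single (l.length : ℤ) c := by
  induction l with
  | nil => exact ⟨1, rfl⟩
  | cons d l ih =>
    obtain ⟨c, hc⟩ := ih
    rw [treeExpr_cons, hc, u, HahnSeries.single_mul_single]
    exact ⟨_, by rw [List.length_cons, add_comm (1 : ℤ)]; push_cast; rfl⟩

lemma lowBd_treeExpr (l : List ℤ) : LowBd l.length (treeExpr m l) := by
  obtain ⟨c, hc⟩ := exists_treeExpr_eq_single (m := m) l
  rw [hc]
  exact lowBd_single _ _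

lemma a_ne_zero (k : ℕ) : a k ≠ 0 := by
  rw [a, Ne, FaithfulSMul.algebraMap_eq_zero_iff]
  exact MvPolynomial.X_ne_zero k

lemma u_ne_zero (j : ℕ) : u m j ≠ 0 := by
  rw [u]
  exact HahnSeries.single_ne_zero (div_ne_zero (neg_ne_zero.mpr (a_ne_zero j)) (a_ne_zero m))

lemma exists_zpow_single (c : K) (z : ℤ) :
    ∃ c' : K, (HahnSeries.single 1 c : L) ^ z = HahnSeries.single z c' := by
  obtain ⟨n, rfl | rfl⟩ := z.eq_nat_or_neg
  · exact ⟨c ^ n, by rw [zpow_natCast, HahnSeries.single_pow]; simp⟩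
  · refine ⟨(c ^ n)⁻¹, ?_⟩
    rw [zpow_neg, zpow_natCast, HahnSeries.single_pow, HahnSeries.inv_single]
    simp

lemma lowBd_u_zpow (j : ℕ) (z : ℤ) : LowBd z (u m j ^ z) := by
  obtain ⟨c, hc⟩ := exists_zpow_single (-(a j) / a m) z
  rw [u, hc]
  exact lowBd_single _ _

lemma lowBd_u (j : ℕ) : LowBd 1 (u m j) := lowBd_single _ _

lemma neg_mul_length_le_sum {c : ℤ} {l : List ℤ} (hl : ∀ x ∈ l, -c ≤ x) :
    -(c * l.length) ≤ l.sum := by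
  induction l with
  | nil => simp
  | cons x l ih =>
    have h1 := ih fun y hy => hl y (List.mem_cons_of_mem _ hy)
    have h2 := hl x List.mem_cons_self
    rw [List.sum_cons, List.length_cons]
    push_cast
    linarith

lemma le_sum_add_mul_length {c : ℤ} (hc : 0 ≤ c) {l : List ℤ} (hl : ∀ x ∈ l, -c ≤ x) {x : ℤ}
    (hx : x ∈ l) : x ≤ l.sum + c * l.length := by
  obtain ⟨s, t, rfl⟩ := List.append_of_mem hx
  have h1 := neg_mul_length_le_sum (c := c) (l := s) fun y hy => hl y (by simp [hy])
  have h2 := neg_mul_length_le_sum (c := c) (l := t) fun y hy => hl y (by simp [hy])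
  simp only [List.sum_append, List.sum_cons, List.length_append, List.length_cons]
  push_cast
  linarith

/-- The steps are at least `-m` and add up to `-1`, so no letter can exceed `m * n`. The lower bound
on the letters of `Luk m` is what makes infinite sums of trees meaningful. -/
lemma finite_luk_length (n : ℕ) : {l | l ∈ Luk m ∧ l.length = n}.Finite := by
  have h := (List.finite_length_eq (Set.Icc (-(m : ℤ) + 1) (m * n)) n).image
    (List.map Subtype.val)
  refine h.subset ?_
  rintro l ⟨hl, rfl⟩
  have hl' : ∀ d ∈ l, d ∈ Set.Icc (-(m : ℤ) + 1) (m * l.length) := by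
    intro d hd
    refine ⟨hl.2 d hd, ?_⟩
    have := le_sum_add_mul_length (c := m) (by positivity) (l := l.map fun d => d - 1)
      (x := d - 1) (fun x hx => by
        obtain ⟨y, hy, rfl⟩ := List.mem_map.mp hx
        have := hl.2 y hy
        omega) (List.mem_map.mpr ⟨d, hd, rfl⟩)
    rw [hl.1.2.2, List.length_map] at this
    linarith
  exact ⟨l.attachWith _ hl', by simp, by simp⟩

lemma summableOn_treeExpr {X : Set (List ℤ)} (hX : X ⊆ Luk m) : SummableOn X (treeExpr m) := by
  refine ⟨⟨0, fun l _ => (lowBd_treeExpr l).mono (by positivity)⟩, fun k => ?_⟩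
  refine (finite_luk_length (m := m) k.toNat).subset ?_
  rintro l ⟨hl, hk⟩
  refine ⟨hX hl, ?_⟩
  obtain ⟨c, hc⟩ := exists_treeExpr_eq_single (m := m) l
  rw [hc] at hk
  have := HahnSeries.eq_of_mem_support_single hk
  omega

lemma sumOn_treeSum {X : Set (List ℤ)} (hX : X ⊆ Luk m) : SumOn X (treeExpr m) (treeSum m X) :=
  (summableOn_treeExpr hX).sumOn_coe

lemma lukPart_subset_luk (i : ℕ) : LukPart m i ⊆ Luk m := fun _ h => h.1

lemma u_mem_R {j : ℕ} (hj : j ≠ m) : u m j ∈ R m := by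
  refine ⟨fun k hk => lowBd_u j k (by omega), fun k => ?_⟩
  rw [u, HahnSeries.coeff_single]
  split_ifs with h
  · obtain rfl : k = 1 := by exact_mod_cast h
    exact Submodule.subset_span ⟨Finsupp.single j 1, by simp [hj], by simp, by simp⟩
  · exact zero_mem _

lemma treeExpr_mem_R {l : List ℤ} (hl : l ∈ Luk m) : treeExpr m l ∈ R m := by
  refine Subring.list_prod_mem _ fun x hx => ?_
  obtain ⟨d, hd, rfl⟩ := List.mem_map.mp hx
  have h1 := hl.1.1 d hd
  have h2 := hl.2 d hd
  -- As `d ≥ -m + 1`, the index `m + d - 1` is not truncated, and `d ≠ 1` keeps it different from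
  -- `m`.
  exact u_mem_R (by omega)

lemma treeSum_mem_R {X : Set (List ℤ)} (hX : X ⊆ Luk m) : treeSum m X ∈ R m := by
  have h := sumOn_treeSum hX
  have h0 := fun l hl => treeExpr_mem_R (hX (a := l) hl)
  refine ⟨fun k hk => ?_, fun k => ?_⟩
  · rw [h.2]
    exact finsum_mem_eq_zero_of_forall_eq_zero fun l hl => (h0 l hl).1 k hk
  · rw [h.2]
    exact finsum_mem_induction (· ∈ gradedPiece m k) (zero_mem _) (fun _ _ => add_mem)
      fun l hl => (h0 l hl).2 k

/-! ### Weights of polynomials -/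

/-- The weight of a monomial in which `x_j` has weight `j + 1`. -/
def weight (α : Fin m →₀ ℕ) : ℤ := ∑ j, (α j : ℤ) * ((j : ℕ) + 1)

lemma weight_add (α β : Fin m →₀ ℕ) : weight (α + β) = weight α + weight β := by
  simp [weight, add_mul, Finset.sum_add_distrib]

lemma weight_single (i : Fin m) : weight (Finsupp.single i 1) = (i : ℕ) + 1 := by
  rw [weight, Finset.sum_eq_single i]
  · simp
  · intro j _ hj
    simp [Finsupp.single_eq_of_ne hj]
  · simp

/-- Every term of the polynomial has degree at least `n` if `x_j` is given the degree `j + 1`. -/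
def WtBd (n : ℤ) (P : MvPolynomial (Fin m) L) : Prop :=
  ∀ α, LowBd (n - weight α) (MvPolynomial.coeff α P)

lemma WtBd.mono {n n' : ℤ} {P : MvPolynomial (Fin m) L} (h : WtBd n P) (hn : n' ≤ n) :
    WtBd n' P := fun α => (h α).mono (by omega)

lemma wtBd_C {n : ℤ} {c : L} (hc : LowBd n c) : WtBd (m := m) n (MvPolynomial.C c) := by
  intro α
  classical
  rw [MvPolynomial.coeff_C]
  split_ifs with h
  · subst h
    simpa [weight] using hc
  · exact lowBd_zero _

lemma wtBd_X (i : Fin m) : WtBd ((i : ℕ) + 1) (MvPolynomial.X i : MvPolynomial (Fin m) L) := by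
  intro α
  classical
  rw [MvPolynomial.coeff_X]
  split_ifs with h
  · subst h
    rw [weight_single, sub_self]
    exact lowBd_one
  · exact lowBd_zero _

lemma WtBd.mul {n n' : ℤ} {P Q : MvPolynomial (Fin m) L} (hP : WtBd n P) (hQ : WtBd n' Q) :
    WtBd (n + n') (P * Q) := by
  classical
  intro α
  rw [MvPolynomial.coeff_mul]
  refine lowBd_sum _ _ fun β hβ => ?_
  rw [← Finset.HasAntidiagonal.mem_antidiagonal.mp hβ, weight_add]
  exact ((hP _).mul (hQ _)).mono (by linarith)

lemma WtBd.pderiv {n : ℤ} {P : MvPolynomial (Fin m) L} (hP : WtBd n P) (j : Fin m) :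
    WtBd (n - ((j : ℕ) + 1)) (MvPolynomial.pderiv j P) := by
  intro α
  rw [MvPolynomial.coeff_pderiv]
  have h1 := hP (α + Finsupp.single j 1)
  rw [weight_add, weight_single] at h1
  have h2 : LowBd 0 ((α j : L) + 1) := by
    have : ((α j : L) + 1) = HahnSeries.single 0 ((α j : K) + 1) := by
      change _ = (HahnSeries.C : K →+* L) ((α j : K) + 1)
      rw [map_add, map_natCast, map_one]
    rw [this]
    exact lowBd_single _ _
  exact (h1.mul h2).mono (by linarith)

lemma LowBd.pow {n : ℤ} {x : L} (hx : LowBd n x) (k : ℕ) : LowBd (k * n) (x ^ k) := by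
  induction k with
  | zero => simpa using lowBd_one
  | succ k ih => rw [pow_succ]; exact (ih.mul hx).mono (by push_cast; linarith)

lemma lowBd_prod {ι : Type*} (s : Finset ι) (n : ι → ℤ) (f : ι → L)
    (h : ∀ x ∈ s, LowBd (n x) (f x)) : LowBd (∑ x ∈ s, n x) (∏ x ∈ s, f x) := by
  classical
  induction s using Finset.induction_on with
  | empty => simpa using lowBd_one
  | insert x s hx ih =>
    rw [Finset.sum_insert hx, Finset.prod_insert hx]
    exact (h x (by simp)).mul (ih fun y hy => h y (by simp [hy]))

lemma lowBd_monomial {v : Fin m → L} (hv : ∀ j : Fin m, LowBd ((j : ℕ) + 1) (v j))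
    (α : Fin m →₀ ℕ) : LowBd (weight α) (∏ j, v j ^ α j) :=
  lowBd_prod _ _ _ fun j _ => (hv j).pow (α j)

/-- A family of polynomials can be evaluated term by term. -/
lemma sumOn_eval {ι : Type} {A : Set ι} {P : ι → MvPolynomial (Fin m) L} {n : ι → ℤ} {c : ℤ}
    (hc : ∀ x ∈ A, c ≤ n x) (hfin : ∀ k, {x | x ∈ A ∧ n x ≤ k}.Finite)
    (hP : ∀ x ∈ A, WtBd (n x) (P x)) {v : Fin m → L}
    (hv : ∀ j : Fin m, LowBd ((j : ℕ) + 1) (v j)) {F : MvPowerSeries (Fin m) L}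
    (hF : ∀ α, SumOn A (fun x => MvPolynomial.coeff α (P x)) (MvPowerSeries.coeff α F)) :
    EvalSummable F v ∧ SumOn A (fun x => MvPolynomial.eval v (P x)) (evalAt F v) := by
  -- One double family is summed in two ways: grouped by monomials it gives `evalAt F v`, grouped by
  -- indices it gives the sum of the polynomial values.
  let s : ι × (Fin m →₀ ℕ) → L := fun p => MvPolynomial.coeff p.2 (P p.1) * ∏ j, v j ^ p.2 j
  have hs0 : ∀ p ∈ A ×ˢ (Set.univ : Set (Fin m →₀ ℕ)), LowBd (n p.1) (s p) := by
    rintro ⟨x, α⟩ ⟨hx, -⟩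
    have := (hP x hx α).mul (lowBd_monomial hv α)
    rwa [sub_add_cancel] at this
  have hs : SummableOn (A ×ˢ (Set.univ : Set (Fin m →₀ ℕ))) s := by
    refine ⟨⟨c, fun p hp => (hs0 p hp).mono (hc _ hp.1)⟩, fun k => ?_⟩
    -- In degree `k` only the finitely many `x` with `n x ≤ k` contribute, each through the finite
    -- support of `P x`.
    refine ((hfin k).biUnion (t := fun x =>
      (fun α => (x, α)) '' ((P x).support : Set (Fin m →₀ ℕ)))
      fun x _ => (Finset.finite_toSet _).image _).subset ?_
    rintro ⟨x, α⟩ ⟨⟨hx, -⟩, hk⟩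
    refine Set.mem_biUnion (x := x) ⟨hx, ?_⟩
      ⟨α, MvPolynomial.mem_support_iff.mpr fun h => hk ?_, rfl⟩
    · by_contra h
      exact hk (hs0 (x, α) ⟨hx, trivial⟩ k (not_le.mp h))
    · simp [s, h]
  have h1 : SumOn Set.univ (fun α => MvPowerSeries.coeff α F * ∏ j, v j ^ α j)
      (formalSum fun p : (A ×ˢ (Set.univ : Set (Fin m →₀ ℕ)) : Set _) => s p) := by
    refine hs.sumOn_coe.fiberwise (B := Set.univ) (p := Prod.snd) (fun _ _ => trivial)
      fun α _ => ?_
    rw [mul_comm]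
    refine ((hF α).const_mul (∏ j, v j ^ α j)).of_bijOn (e := fun x => (x, α))
      ⟨fun x hx => ⟨⟨hx, trivial⟩, rfl⟩, fun x _ y _ h => (Prod.ext_iff.mp h).1, ?_⟩
      fun x _ => mul_comm _ _
    rintro ⟨x, β⟩ ⟨⟨hx, -⟩, rfl⟩
    exact ⟨x, hx, rfl⟩
  have h2 : SumOn A (fun x => MvPolynomial.eval v (P x))
      (formalSum fun p : (A ×ˢ (Set.univ : Set (Fin m →₀ ℕ)) : Set _) => s p) := by
    refine hs.sumOn_coe.fiberwise (p := Prod.fst) (fun p hp => hp.1) fun x hx => ?_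
    rw [MvPolynomial.eval_eq']
    refine ((sumOn_finset (P x).support fun α =>
      MvPolynomial.coeff α (P x) * ∏ j, v j ^ α j).superset (Set.subset_univ _)
      fun α _ hα => ?_).of_bijOn (e := fun α => (x, α))
      ⟨fun α _ => ⟨⟨hx, trivial⟩, rfl⟩, fun α _ β _ h => (Prod.ext_iff.mp h).2, ?_⟩ fun _ _ => rfl
    · rw [Finset.mem_coe, MvPolynomial.notMem_support_iff] at hα
      rw [hα, zero_mul]
    · rintro ⟨y, α⟩ ⟨-, rfl⟩
      exact ⟨α, trivial, rfl⟩
  refine ⟨formallySummable_iff.mpr h1.1, ?_⟩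
  rw [evalAt, h1.1.sumOn_univ.unique h1]
  exact h2

/-! ### The auxiliary functions -/

instance : Finite (PartialBlock m) := by
  let f : PartialBlock m → Fin 4 × Fin (m + 1) × Fin (m + 1) × Fin (m + 1)
    | .one i => (0, i.castSucc, 0, 0)
    | .oneT0 => (1, 0, 0, 0)
    | .triple i k h _ _ _ _ _ => (2, i.castSucc, ⟨k, by omega⟩, ⟨h, by omega⟩)
    | .tripleT0 k _ _ => (3, 0, ⟨k, by omega⟩, 0)
  refine Finite.of_injective f fun b b' h => ?_
  cases b <;> cases b' <;> simp_all [f]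

lemma finite_partialTree (A : Set (PartialTree m)) (c k : ℤ) :
    {T | T ∈ A ∧ (T.length : ℤ) + c ≤ k}.Finite :=
  (List.finite_length_le (PartialBlock m) (k - c).toNat).subset fun T hT => by
    have := hT.2
    simp only [Set.mem_ofPred_eq]
    omega

/-- For a triple the weight is `(i + 1) + (k - 2 - h) + 1`, and `i ≥ h - (k - 2)` compensates the
negative power. Hence long partial trees have high degree although negative exponents occur. -/
lemma wtBd_blockExpr (b : PartialBlock m) : WtBd 1 b.expr := by
  cases b with
  | one i => exact (wtBd_X i).mono (by omega)
  | oneT0 => exact wtBd_C (lowBd_u _)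
  | triple i k h h1 h2 h3 h4 h5 =>
    exact (((wtBd_X i).mul (wtBd_C (lowBd_u_zpow _ _))).mul (wtBd_C (lowBd_u _))).mono (by omega)
  | tripleT0 k h1 h2 => exact wtBd_C (lowBd_u _)

lemma wtBd_prod (T : PartialTree m) : WtBd T.length (T.map PartialBlock.expr).prod := by
  induction T with
  | nil => simpa using wtBd_C lowBd_one
  | cons b T ih =>
    rw [List.map_cons, List.prod_cons]
    exact ((wtBd_blockExpr b).mul ih).mono (by push_cast [List.length_cons]; omega)

lemma wtBd_expr (T : PartialTree m) : WtBd (T.length + 1) (PartialTree.expr T) := by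
  rw [PartialTree.expr]
  split_ifs
  · exact ((wtBd_C (lowBd_u _)).mul (wtBd_prod T)).mono (by omega)
  · exact fun α => by simpa using lowBd_zero _

lemma summableOn_coeff_expr (A : Set (PartialTree m)) (α : Fin m →₀ ℕ) :
    SummableOn A (fun T => MvPolynomial.coeff α (PartialTree.expr T)) := by
  refine ⟨⟨-weight α, fun T _ => (wtBd_expr T α).mono (by omega)⟩, fun k => ?_⟩
  refine (finite_partialTree A (1 - weight α) k).subset fun T hT => ⟨hT.1, ?_⟩
  by_contra h
  exact hT.2 (wtBd_expr T α k (by omega))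

/-- The partial trees that contribute to `f_{i,m}`. -/
def partialTrees (i : Fin m) : Set (PartialTree m) := {T | PartialTree.terminal T = i}

lemma sumOn_coeff_auxFun (i : Fin m) (α : Fin m →₀ ℕ) :
    SumOn (partialTrees i) (fun T => MvPolynomial.coeff α (PartialTree.expr T))
      (MvPowerSeries.coeff α (auxFun m i)) :=
  (summableOn_coeff_expr (partialTrees i) α).sumOn_coe

lemma sumOn_coeff_partialDeriv (i j : Fin m) (α : Fin m →₀ ℕ) :
    SumOn (partialTrees i)
      (fun T => MvPolynomial.coeff α (MvPolynomial.pderiv j (PartialTree.expr T)))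
      (MvPowerSeries.coeff α (partialDeriv j (auxFun m i))) := by
  rw [partialDeriv, MvPowerSeries.coeff_pderiv, mul_comm]
  refine ((sumOn_coeff_auxFun i _).const_mul _).congr fun T _ => ?_
  rw [MvPolynomial.coeff_pderiv, mul_comm]

variable {v : Fin m → L}

lemma evalAt_auxFun (hv : ∀ j : Fin m, LowBd ((j : ℕ) + 1) (v j)) (i : Fin m) :
    EvalSummable (auxFun m i) v ∧
      SumOn (partialTrees i) (fun T => MvPolynomial.eval v (PartialTree.expr T))
        (evalAt (auxFun m i) v) :=
  sumOn_eval (c := 0) (fun T _ => by positivity) (finite_partialTree _ 1) (fun T _ => wtBd_expr T)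
    hv (sumOn_coeff_auxFun i)

lemma evalAt_partialDeriv (hv : ∀ j : Fin m, LowBd ((j : ℕ) + 1) (v j)) (i j : Fin m) :
    EvalSummable (partialDeriv j (auxFun m i)) v ∧
      SumOn (partialTrees i)
        (fun T => MvPolynomial.eval v (MvPolynomial.pderiv j (PartialTree.expr T)))
        (evalAt (partialDeriv j (auxFun m i)) v) :=
  sumOn_eval (c := -(j : ℕ)) (n := fun T => (T.length : ℤ) + (1 - ((j : ℕ) + 1)))
    (fun T _ => by omega) (finite_partialTree _ _)
    (fun T _ => ((wtBd_expr T).pderiv j).mono (by omega)) hv (sumOn_coeff_partialDeriv i j)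

/-! ### Filling the blocks of a partial tree -/

/-- The negative power in a triple cancels the factors of the `h + 2 - k` zeros removed from `t`. A
constant evaluation point suffices, since at most one variable occurs. -/
lemma ValidBlock.treeExpr_eq (hm : 1 ≤ m) {b : PartialBlock m} {t : List ℤ}
    (h : ValidBlock b t) :
    treeExpr m (blockWord b t) = MvPolynomial.eval (fun _ => treeExpr m t) b.expr := by
  cases b with
  | one i => simp [blockWord, PartialBlock.expr]
  | oneT0 =>
    obtain rfl : t = T0 := h
    rw [blockWord, PartialBlock.expr, MvPolynomial.eval_C]
    simpa [T0] using treeExpr_replicate_zero hm 1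
  | triple i k h' h1 h2 h3 h4 h5 =>
    obtain ⟨d, hd, l, hl, ht, -⟩ := exists_trim (i := i) h (r := h' + 2 - k) (by omega)
    simp only [blockWord, PartialBlock.expr, map_mul, MvPolynomial.eval_X, MvPolynomial.eval_C]
    rw [ht, hl, treeExpr_append, treeExpr_append, treeExpr_replicate_zero hm,
      treeExpr_cons (-(h' : ℤ)), treeExpr_nil, mul_one,
      show ((m : ℤ) + -(h' : ℤ) - 1).toNat = m - 1 - h' by omega,
      mul_assoc (treeExpr m _) (_ ^ _) (_ ^ _), ← zpow_natCast, ← zpow_add₀ (u_ne_zero _),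
      show ((h' + 2 - k : ℕ) : ℤ) + (k - 2 - h') = 0 by omega, zpow_zero, mul_one]
  | tripleT0 k h1 h2 =>
    rw [blockWord, PartialBlock.expr, MvPolynomial.eval_C, treeExpr_cons, treeExpr_nil, mul_one]
    congr 1
    omega

/-- The trees from `X` that may be the first tree of a block. -/
def fillings (X : Set (List ℤ)) (b : PartialBlock m) : Set (List ℤ) :=
  {t | ValidBlock b t ∧ (2 ≤ rootDegree t → t ∈ X)}

lemma two_le_rootDegree_of_mem_lukPart {i : ℕ} {t : List ℤ} (h : t ∈ LukPart m i) :
    2 ≤ rootDegree t := by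
  obtain ⟨d, hd, l, rfl, -⟩ := exists_of_mem_lukPart h
  simpa [rootDegree] using hd

lemma fillings_of_lukPart {X : Set (List ℤ)} {b : PartialBlock m} {i : Fin m}
    (h : ∀ t, ValidBlock b t ↔ t ∈ LukPart m i) : fillings X b = X ∩ LukPart m i := by
  ext t
  simp only [fillings, Set.mem_ofPred_eq, h, Set.mem_inter_iff]
  constructor
  · rintro ⟨h1, h2⟩
    exact ⟨h2 (two_le_rootDegree_of_mem_lukPart h1), h1⟩
  · rintro ⟨h1, h2⟩
    exact ⟨h2, fun _ => h1⟩

lemma fillings_of_T0 {X : Set (List ℤ)} {b : PartialBlock m}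
    (h : ∀ t, ValidBlock b t ↔ t = T0) : fillings X b = {T0} := by
  ext t
  simp only [fillings, Set.mem_ofPred_eq, h, Set.mem_singleton_iff, and_iff_left_iff_imp]
  rintro rfl h2
  exact absurd h2 (by simp [rootDegree, T0])

/-- The expression is constant or a multiple of one variable `x_i`, so summing over the first trees
replaces `x_i` by `S_i(X)`. -/
lemma sumOn_block (hm : 1 ≤ m) {X : Set (List ℤ)} (hX : X ⊆ Luk m) (b : PartialBlock m) :
    SumOn (fillings X b) (fun t => treeExpr m (blockWord b t))
      (MvPolynomial.eval (SOf m X) b.expr) := by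
  have hS : ∀ i : Fin m, SumOn (X ∩ LukPart m i) (treeExpr m) (SOf m X i) :=
    fun i => sumOn_treeSum (Set.inter_subset_left.trans hX)
  cases b with
  | one i =>
    rw [fillings_of_lukPart (i := i) fun _ => Iff.rfl, PartialBlock.expr, MvPolynomial.eval_X]
    exact hS i
  | oneT0 =>
    rw [fillings_of_T0 fun _ => Iff.rfl, PartialBlock.expr, MvPolynomial.eval_C]
    convert sumOn_singleton _ T0 using 1
    rw [ValidBlock.treeExpr_eq (b := .oneT0) (t := T0) hm rfl, PartialBlock.expr,
      MvPolynomial.eval_C]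
  | triple i k h h1 h2 h3 h4 h5 =>
    rw [fillings_of_lukPart (i := i) fun _ => Iff.rfl]
    have hsum := (hS i).const_mul (u m (m - 1) ^ ((k : ℤ) - 2 - (h : ℤ)) * u m (m - 1 - h))
    simp only [PartialBlock.expr, map_mul, MvPolynomial.eval_X, MvPolynomial.eval_C]
    rw [mul_assoc, mul_comm]
    refine hsum.congr fun t ht => ?_
    rw [ValidBlock.treeExpr_eq (b := .triple i k h h1 h2 h3 h4 h5) hm ht.2]
    simp only [PartialBlock.expr, map_mul, MvPolynomial.eval_X, MvPolynomial.eval_C]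
    ring
  | tripleT0 k h1 h2 =>
    rw [fillings_of_T0 fun _ => Iff.rfl, PartialBlock.expr, MvPolynomial.eval_C]
    convert sumOn_singleton _ T0 using 1
    rw [ValidBlock.treeExpr_eq (b := .tripleT0 k h1 h2) (t := T0) hm rfl, PartialBlock.expr,
      MvPolynomial.eval_C]

/-- The expression is a constant multiple of `x_j`, hence its value is that of `x_j` times its
derivative, and the derivative may be evaluated at any `v`. -/
lemma treeExpr_eq_mul_pderiv (hm : 1 ≤ m) {b : PartialBlock m} {j : Fin m} {t : List ℤ}
    (ht : t ∈ LukPart m j) (hb : ValidBlock b t) :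
    treeExpr m (blockWord b t) =
      treeExpr m t * MvPolynomial.eval v (MvPolynomial.pderiv j b.expr) := by
  rw [hb.treeExpr_eq hm]
  cases b with
  | one i =>
    obtain rfl := lukPart_unique ht hb
    simp [PartialBlock.expr]
  | oneT0 => exact absurd hb ht.2.1
  | triple i k h h1 h2 h3 h4 h5 =>
    obtain rfl := lukPart_unique ht hb
    simp only [PartialBlock.expr, MvPolynomial.pderiv_mul, MvPolynomial.pderiv_X_self,
      MvPolynomial.pderiv_C, map_mul, MvPolynomial.eval_X, MvPolynomial.eval_C, map_add, map_one,
      map_zero]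
    ring
  | tripleT0 k h1 h2 => exact absurd hb ht.2.1

lemma eval_pderiv_eq_zero {b : PartialBlock m} {j : Fin m} {t : List ℤ}
    (ht : t ∈ LukPart m j) (hb : ¬ ValidBlock b t) :
    MvPolynomial.eval v (MvPolynomial.pderiv j b.expr) = 0 := by
  cases b with
  | one i =>
    have hij : i ≠ j := by rintro rfl; exact hb ht
    simp [PartialBlock.expr, MvPolynomial.pderiv_X_of_ne hij]
  | oneT0 => simp [PartialBlock.expr]
  | triple i k h h1 h2 h3 h4 h5 =>
    have hij : i ≠ j := by rintro rfl; exact hb ht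
    simp [PartialBlock.expr, MvPolynomial.pderiv_X_of_ne hij]
  | tripleT0 k h1 h2 => simp [PartialBlock.expr]

lemma sumOn_block_with (hm : 1 ≤ m) (b : PartialBlock m) {j : Fin m} {T₁ : List ℤ}
    (hT₁ : T₁ ∈ LukPart m j) :
    SumOn {t | t = T₁ ∧ ValidBlock b t} (fun t => treeExpr m (blockWord b t))
      (treeExpr m T₁ * MvPolynomial.eval v (MvPolynomial.pderiv j b.expr)) := by
  by_cases hb : ValidBlock b T₁
  · have : {t | t = T₁ ∧ ValidBlock b t} = {T₁} := by
      ext t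
      exact ⟨fun h => h.1, fun h => ⟨h, h ▸ hb⟩⟩
    rw [this, ← treeExpr_eq_mul_pderiv hm hT₁ hb]
    exact sumOn_singleton _ _
  · have : {t | t = T₁ ∧ ValidBlock b t} = ∅ := by
      ext t
      exact ⟨fun h => hb (h.1 ▸ h.2), fun h => h.elim⟩
    rw [this, eval_pderiv_eq_zero hT₁ hb, mul_zero]
    exact sumOn_empty _

/-- The sequences of blocks of a given shape with first trees from `X`. -/
def seqFillings (X : Set (List ℤ)) (T : PartialTree m) : Set (BlockSeq m) :=
  {ω | shape ω = T ∧ ∀ x ∈ ω, x.2 ∈ fillings X x.1}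

/-- The sequences of blocks of a given shape whose first trees are `T₁` once and otherwise belong
to `X`. -/
def seqFillingsWith (X : Set (List ℤ)) (T₁ : List ℤ) (T : PartialTree m) : Set (BlockSeq m) :=
  {ω | shape ω = T ∧ ValidSeq ω ∧ (ω.map Prod.snd).count T₁ = 1 ∧
    ∀ x ∈ ω, x.2 ≠ T₁ → 2 ≤ rootDegree x.2 → x.2 ∈ X}

/-- A block is put in front of a sequence of blocks. -/
lemma SumOn.cons {b : PartialBlock m} {A : Set (List ℤ)} {B C : Set (BlockSeq m)} {r r' : L}
    (hA : SumOn A (fun t => treeExpr m (blockWord b t)) r)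
    (hB : SumOn B (fun ω => treeExpr m (forestWord ω)) r')
    (hC : ∀ ω, ω ∈ C ↔ ∃ t ω', ω = (b, t) :: ω' ∧ t ∈ A ∧ ω' ∈ B) :
    SumOn C (fun ω => treeExpr m (forestWord ω)) (r * r') := by
  refine (hA.prod hB).of_bijOn (e := fun p => (b, p.1) :: p.2) ⟨?_, ?_, ?_⟩ ?_
  · rintro ⟨t, ω⟩ ⟨ht, hω⟩
    exact (hC _).mpr ⟨t, ω, rfl, ht, hω⟩
  · rintro ⟨t, ω⟩ - ⟨t', ω'⟩ - h
    simpa using h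
  · intro ω hω
    obtain ⟨t, ω', rfl, ht, hω'⟩ := (hC ω).mp hω
    exact ⟨(t, ω'), ⟨ht, hω'⟩, rfl⟩
  · rintro ⟨t, ω⟩ -
    rw [forestWord_cons, treeExpr_append]

lemma sumOn_seqFillings (hm : 1 ≤ m) {X : Set (List ℤ)} (hX : X ⊆ Luk m) (T : PartialTree m) :
    SumOn (seqFillings X T) (fun ω => treeExpr m (forestWord ω))
      (MvPolynomial.eval (SOf m X) (T.map PartialBlock.expr).prod) := by
  induction T with
  | nil =>
    have : seqFillings X ([] : PartialTree m) = {[]} := by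
      ext ω
      simp only [seqFillings, Set.mem_ofPred_eq, shape, List.map_eq_nil_iff,
        Set.mem_singleton_iff, and_iff_left_iff_imp]
      rintro rfl x hx
      simp at hx
    rw [this]
    simpa [forestWord] using sumOn_singleton (fun ω : BlockSeq m => treeExpr m (forestWord ω)) []
  | cons b T ih =>
    rw [List.map_cons, List.prod_cons, map_mul]
    refine (sumOn_block hm hX b).cons ih fun ω => ?_
    simp only [seqFillings, Set.mem_ofPred_eq]
    constructor
    · rintro ⟨h1, h2⟩
      obtain ⟨⟨b', t⟩, ω', rfl, rfl, h3⟩ := List.map_eq_cons_iff.mp h1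
      exact ⟨t, ω', rfl, h2 _ List.mem_cons_self, h3, fun x hx => h2 x (List.mem_cons_of_mem _ hx)⟩
    · rintro ⟨t, ω', rfl, h1, rfl, h3⟩
      exact ⟨rfl, List.forall_mem_cons.mpr ⟨h1, h3⟩⟩

/-- This is the Leibniz rule: `T₁` fills either the first block or one of the others. Since `T₁ ∉
X`, fillings from `X` avoid `T₁`, which makes the two cases disjoint and the count exactly one. -/
lemma sumOn_seqFillingsWith (hm : 1 ≤ m) {X : Set (List ℤ)} (hX : X ⊆ Luk m) {j : Fin m}
    {T₁ : List ℤ} (hT₁ : T₁ ∈ LukPart m j) (hT₁X : T₁ ∉ X) (T : PartialTree m) :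
    SumOn (seqFillingsWith X T₁ T) (fun ω => treeExpr m (forestWord ω))
      (treeExpr m T₁ *
        MvPolynomial.eval (SOf m X) (MvPolynomial.pderiv j (T.map PartialBlock.expr).prod)) := by
  have hdeg := two_le_rootDegree_of_mem_lukPart hT₁
  have hne : ∀ {b : PartialBlock m} {t}, t ∈ fillings X b → t ≠ T₁ := by
    rintro b t ht rfl
    exact hT₁X (ht.2 hdeg)
  induction T with
  | nil =>
    have : seqFillingsWith X T₁ ([] : PartialTree m) = ∅ := by
      ext ω
      simp only [seqFillingsWith, Set.mem_ofPred_eq, shape, List.map_eq_nil_iff,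
        Set.mem_empty_iff_false, iff_false]
      rintro ⟨rfl, -, h, -⟩
      simp at h
    rw [this]
    simpa using sumOn_empty _
  | cons b T ih =>
    have hs1 : SumOn {ω : BlockSeq m | ∃ t ω', ω = (b, t) :: ω' ∧ t ∈ {t | t = T₁ ∧ ValidBlock b t} ∧
        ω' ∈ seqFillings X T} _ _ :=
      (sumOn_block_with (v := SOf m X) hm b hT₁).cons (sumOn_seqFillings hm hX T) fun ω => Iff.rfl
    have hs2 : SumOn {ω : BlockSeq m | ∃ t ω', ω = (b, t) :: ω' ∧ t ∈ fillings X b ∧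
        ω' ∈ seqFillingsWith X T₁ T} _ _ :=
      (sumOn_block hm hX b).cons ih fun ω => Iff.rfl
    have hs := hs1.union hs2 (by
      rw [Set.disjoint_left]
      rintro _ ⟨t, ω, rfl, ht, -⟩ ⟨t', ω', h, ht', -⟩
      simp only [List.cons.injEq, Prod.mk.injEq, true_and] at h
      exact hne ht' (h.1 ▸ ht.1))
    rw [List.map_cons, List.prod_cons, MvPolynomial.pderiv_mul, map_add, map_mul, map_mul]
    clear hs1 hs2 ih
    convert hs using 1
    · clear hs
      ext ω
      simp only [seqFillingsWith, seqFillings, Set.mem_ofPred_eq, Set.mem_union]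
      constructor
      · rintro ⟨h1, h2, h3, h4⟩
        obtain ⟨⟨b', t⟩, ω, rfl, rfl, h5⟩ := List.map_eq_cons_iff.mp h1
        obtain ⟨h6, h7⟩ := List.forall_mem_cons.mp h2
        obtain ⟨h8, h9⟩ := List.forall_mem_cons.mp h4
        rw [List.map_cons, List.count_cons] at h3
        by_cases ht : t = T₁
        · subst ht
          have h10 : (ω.map Prod.snd).count t = 0 := by simpa using h3
          refine Or.inl ⟨t, ω, rfl, ⟨rfl, h6⟩, h5, fun x hx => ⟨h7 x hx, h9 x hx fun hxt => ?_⟩⟩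
          exact List.count_eq_zero.mp h10 (List.mem_map.mpr ⟨x, hx, hxt⟩)
        · refine Or.inr ⟨t, ω, rfl, ⟨h6, h8 ht⟩, h5, h7, ?_, h9⟩
          simpa [ht] using h3
      · rintro (⟨t, ω, rfl, ⟨rfl, h1⟩, rfl, h3⟩ | ⟨t, ω, rfl, h1, rfl, h3, h4, h5⟩)
        · refine ⟨rfl, List.forall_mem_cons.mpr ⟨h1, fun x hx => (h3 x hx).1⟩, ?_,
            List.forall_mem_cons.mpr ⟨fun h => absurd rfl h, fun x hx _ => (h3 x hx).2⟩⟩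
          have : (ω.map Prod.snd).count t = 0 := by
            rw [List.count_eq_zero, List.mem_map]
            rintro ⟨x, hx, hxt⟩
            exact hne (h3 x hx) hxt
          simp [this]
        · refine ⟨rfl, List.forall_mem_cons.mpr ⟨h1.1, h3⟩, ?_,
            List.forall_mem_cons.mpr ⟨fun _ => h1.2, h5⟩⟩
          rwa [List.map_cons, List.count_cons_of_ne (hne h1)]
    · ring

/-! ### The substitution and derivative properties -/

/-- A tree with index `j` has at least `j` terminal zeros and a root; this justifies the weight `j +
1` of `x_j`. -/
lemma lowBd_SOf {X : Set (List ℤ)} (hX : X ⊆ Luk m) (j : Fin m) :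
    LowBd ((j : ℕ) + 1) (SOf m X j) := by
  refine (sumOn_treeSum (Set.inter_subset_left.trans hX)).lowBd fun t ht => ?_
  refine (lowBd_treeExpr t).mono ?_
  have h1 := le_terminal_of_mem_lukPart ht.2
  obtain ⟨d, hd, l, hl, -⟩ := exists_of_mem_lukPart ht.2
  have h2 := terminal_lt_length (d := d) (by omega) l
  rw [← hl] at h2
  omega

lemma treeExpr_treeWord (hm : 1 ≤ m) (ω : BlockSeq m) :
    treeExpr m (treeWord ω) =
      u m (m - 1 + PartialTree.rootDegree (shape ω)) * treeExpr m (forestWord ω) := by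
  rw [treeWord, treeExpr_cons]
  congr 2
  omega

lemma expr_of_two_le {T : PartialTree m} (hT : 2 ≤ PartialTree.rootDegree T) :
    PartialTree.expr T = MvPolynomial.C (u m (m - 1 + PartialTree.rootDegree T)) *
      (T.map PartialBlock.expr).prod := if_pos hT

lemma expr_of_lt_two {T : PartialTree m} (hT : ¬ 2 ≤ PartialTree.rootDegree T) :
    PartialTree.expr T = 0 := if_neg hT

/-- Sums of trees, grouped by the underlying partial tree. -/
lemma sumOn_partialTrees (hm : 1 ≤ m) {i : Fin m} {p : BlockSeq m → Prop} {A : Set (List ℤ)}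
    (hA : A ⊆ LukPart m i) (hp : ∀ ω : BlockSeq m, ValidSeq ω →
      2 ≤ PartialTree.rootDegree (shape ω) → treeWord ω ∈ LukPart m i →
      (p ω ↔ treeWord ω ∈ A))
    {g : PartialTree m → L} (hg : ∀ T, ¬ 2 ≤ PartialTree.rootDegree T → g T = 0)
    (hg' : ∀ T, 2 ≤ PartialTree.rootDegree T → ∃ r,
      SumOn {ω | shape ω = T ∧ ValidSeq ω ∧ p ω} (fun ω => treeExpr m (forestWord ω)) r ∧
        g T = u m (m - 1 + PartialTree.rootDegree T) * r) :
    SumOn (partialTrees i) g (treeSum m A) := by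
  have hbij : Set.BijOn treeWord {ω : BlockSeq m | (ValidSeq ω ∧
      2 ≤ PartialTree.rootDegree (shape ω)) ∧ PartialTree.terminal (shape ω) = i ∧ p ω} A := by
    have h := bijOn_treeWord hm
    refine ⟨fun ω hω => ?_, h.injOn.mono fun ω hω => hω.1, fun l hl => ?_⟩
    · exact (hp ω hω.1.1 hω.1.2 ((hω.1.1.mem_lukPart_iff hm hω.1.2).mpr hω.2.1)).mp hω.2.2
    · obtain ⟨ω, hω, rfl⟩ := h.surjOn ⟨(hA hl).1, (hA hl).2.1⟩
      exact ⟨ω, ⟨hω, (hω.1.mem_lukPart_iff hm hω.2).mp (hA hl),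
        (hp ω hω.1 hω.2 (hA hl)).mpr hl⟩, rfl⟩
  -- The sum over trees becomes a sum over block sequences, which is then grouped by shape.
  have hsum := (sumOn_treeSum (hA.trans (lukPart_subset_luk i))).of_bijOn' hbij fun _ _ => rfl
  refine hsum.fiberwise (p := shape) (fun ω hω => hω.2.1) fun T hT => ?_
  by_cases hT2 : 2 ≤ PartialTree.rootDegree T
  · obtain ⟨r, hr, hgT⟩ := hg' T hT2
    rw [hgT]
    have h2 := (hr.const_mul (u m (m - 1 + PartialTree.rootDegree T))).congr
      (t := fun ω => treeExpr m (treeWord ω)) fun ω hω => by rw [treeExpr_treeWord hm, hω.1]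
    convert h2 using 1
    ext ω
    simp only [Set.mem_ofPred_eq]
    constructor
    · rintro ⟨⟨⟨h1, -⟩, -, h3⟩, h4⟩
      exact ⟨h4, h1, h3⟩
    · rintro ⟨rfl, h1, h3⟩
      exact ⟨⟨⟨h1, hT2⟩, hT, h3⟩, rfl⟩
  · rw [hg T hT2]
    convert sumOn_empty _ using 1
    ext ω
    simp only [Set.mem_ofPred_eq, Set.mem_empty_iff_false, iff_false]
    rintro ⟨⟨⟨-, h2⟩, -⟩, rfl⟩
    exact hT2 h2

/-- A property of all root subtrees that holds for `T0` depends only on the first trees. -/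
lemma ValidSeq.forall_mem_rootSubtrees {ω : BlockSeq m} (h : ValidSeq ω) {q : List ℤ → Prop}
    (hq : q T0) : (∀ t ∈ NRS.rootSubtrees (treeWord ω), q t) ↔ ∀ x ∈ ω, q x.2 := by
  rw [h.rootSubtrees]
  constructor
  · intro h x hx
    exact h x.2 (List.mem_flatMap.mpr ⟨x, hx, List.mem_cons_self⟩)
  · intro h t ht
    obtain ⟨x, hx, ht⟩ := List.mem_flatMap.mp ht
    rcases List.mem_cons.mp ht with rfl | ht
    · exact h x hx
    · rw [(List.mem_replicate.mp ht).2]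
      exact hq

/-- All root subtrees of a block other than its first tree are `T0`. -/
lemma ValidSeq.count_rootSubtrees {ω : BlockSeq m} (h : ValidSeq ω) {t : List ℤ} (ht : t ≠ T0) :
    (NRS.rootSubtrees (treeWord ω)).count t = (ω.map Prod.snd).count t := by
  rw [h.rootSubtrees]
  clear h
  induction ω with
  | nil => rfl
  | cons x ω ih =>
    rw [List.flatMap_cons, List.count_append, ih, List.map_cons, blockSubtrees, List.count_cons,
      List.count_cons, List.count_replicate]
    have : (T0 == t) = false := by simpa using ht.symm
    simp only [this]
    simp [add_comm]

lemma not_two_le_rootDegree_T0 : ¬ 2 ≤ rootDegree T0 := by simp [rootDegree, T0]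

lemma evalAt_auxFun_SOf (hm : 1 ≤ m) {X : Set (List ℤ)} (hX : X ⊆ Luk m) (i : Fin m) :
    evalAt (auxFun m i) (SOf m X) = treeSum m (subtreesIn m X ∩ LukPart m i) := by
  refine (evalAt_auxFun (lowBd_SOf hX) i).2.unique ?_
  refine sumOn_partialTrees hm Set.inter_subset_right
    (p := fun ω => ∀ x ∈ ω, 2 ≤ rootDegree x.2 → x.2 ∈ X) (fun ω hω _ hl => ?_)
    (fun T hT => by rw [expr_of_lt_two hT, map_zero]) fun T hT => ?_
  · rw [← hω.forall_mem_rootSubtrees (q := fun t => 2 ≤ rootDegree t → t ∈ X)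
      fun h => absurd h not_two_le_rootDegree_T0]
    exact ⟨fun h => ⟨⟨hl.1, h⟩, hl⟩, fun h => h.1.2⟩
  · refine ⟨_, ?_, by rw [expr_of_two_le hT, map_mul, MvPolynomial.eval_C]⟩
    convert sumOn_seqFillings hm hX T using 1
    ext ω
    exact and_congr_right fun _ => (forall₂_and).symm

lemma treeExpr_mul_evalAt_partialDeriv (hm : 1 ≤ m) {X : Set (List ℤ)} (hX : X ⊆ Luk m)
    (i : Fin m) {j : Fin m} {T₁ : List ℤ} (hT₁ : T₁ ∈ LukPart m j) (hT₁X : T₁ ∉ X) :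
    treeExpr m T₁ * evalAt (partialDeriv j (auxFun m i)) (SOf m X) =
      treeSum m (subtreesInWith m X T₁ ∩ LukPart m i) := by
  refine ((evalAt_partialDeriv (lowBd_SOf hX) i j).2.const_mul (treeExpr m T₁)).unique ?_
  refine sumOn_partialTrees hm Set.inter_subset_right
    (p := fun ω => (ω.map Prod.snd).count T₁ = 1 ∧
      ∀ x ∈ ω, x.2 ≠ T₁ → 2 ≤ rootDegree x.2 → x.2 ∈ X) (fun ω hω _ hl => ?_)
    (fun T hT => by rw [expr_of_lt_two hT, map_zero, map_zero, mul_zero]) fun T hT => ?_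
  · rw [← hω.forall_mem_rootSubtrees (q := fun t => t ≠ T₁ → 2 ≤ rootDegree t → t ∈ X)
      fun _ h => absurd h not_two_le_rootDegree_T0, ← hω.count_rootSubtrees hT₁.2.1]
    exact ⟨fun h => ⟨⟨hl.1, h⟩, hl⟩, fun h => h.1.2⟩
  · refine ⟨_, sumOn_seqFillingsWith hm hX hT₁ hT₁X T, ?_⟩
    rw [expr_of_two_le hT, MvPolynomial.pderiv_C_mul, map_mul, MvPolynomial.eval_C]
    ring

/-! ### Types -/

lemma le_foldr_max {τ : List ℕ} {t : ℕ} (ht : t ∈ τ) : t ≤ τ.foldr max 0 := by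
  induction τ with
  | nil => simp at ht
  | cons x τ ih =>
    rw [List.foldr_cons]
    rcases List.mem_cons.mp ht with rfl | ht
    · exact le_max_left _ _
    · exact (ih ht).trans (le_max_right _ _)

lemma foldr_max_mem {τ : List ℕ} (h : τ ≠ []) : τ.foldr max 0 ∈ τ := by
  induction τ with
  | nil => exact absurd rfl h
  | cons x τ ih =>
    rw [List.foldr_cons]
    by_cases hτ : τ = []
    · simp [hτ]
    · rcases max_choice x (τ.foldr max 0) with h | h <;> rw [h]
      · exact List.mem_cons_self
      · exact List.mem_cons_of_mem _ (ih hτ)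

/-- If the maximum is `0`, every entry attains it, so it occurs at least twice. -/
lemma one_le_typeOf {τ : List ℕ} (h : 2 ≤ τ.length) : 1 ≤ typeOf τ := by
  have h0 : τ ≠ [] := by rintro rfl; simp at h
  rw [typeOf, if_neg h0]
  split_ifs with h1
  · omega
  · by_contra h2
    have h3 : τ.foldr max 0 = 0 := by omega
    have h4 : τ.count 0 = τ.length := List.count_eq_length.mpr fun t ht => by
      have := le_foldr_max ht
      omega
    rw [h3] at h1
    omega

/-- Two entries equal to `n` would raise the type to `n + 1`. This is why only values and first
derivatives of the auxiliary functions are needed. -/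
lemma typeOf_le_iff {τ : List ℕ} (h : τ ≠ []) (n : ℕ) :
    typeOf τ ≤ n ↔ (∀ t ∈ τ, t < n) ∨ (τ.count n = 1 ∧ ∀ t ∈ τ, t ≤ n) := by
  have hmem := foldr_max_mem h
  have hle := fun t ht => le_foldr_max (τ := τ) (t := t) ht
  rw [typeOf, if_neg h]
  generalize τ.foldr max 0 = M at *
  have hM : 1 ≤ τ.count M := List.one_le_count_iff.mpr hmem
  constructor
  · intro h1
    split_ifs at h1 with h2
    · exact Or.inl fun t ht => by have := hle t ht; omega
    · rcases h1.lt_or_eq with h3 | rfl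
      · exact Or.inl fun t ht => (hle t ht).trans_lt h3
      · exact Or.inr ⟨by omega, hle⟩
  · rintro (h1 | ⟨h1, h2⟩)
    · have := h1 M hmem
      split_ifs <;> omega
    · have h3 : n ∈ τ := List.one_le_count_iff.mp h1.ge
      obtain rfl : M = n := le_antisymm (h2 M hmem) (hle n h3)
      rw [h1, if_neg (by omega)]

lemma length_rootSubtrees {i : ℕ} {l : List ℤ} (hl : l ∈ LukPart m i) :
    2 ≤ (rootSubtrees l).length := by
  obtain ⟨d, hd, l', rfl, h⟩ := exists_of_mem_lukPart hl
  rw [rootSubtrees, toTree_cons h, List.length_map]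
  exact hd.trans (length_parse (path_steps_expand le_rfl h)).ge

lemma typeNumber_eq_typeOf (hm : 1 ≤ m) {i : ℕ} {l : List ℤ} (hl : l ∈ LukPart m i) :
    typeNumber l = typeOf ((rootSubtrees l).map typeNumber) := by
  obtain ⟨ω, hω, rfl⟩ := (bijOn_treeWord hm).surjOn ⟨hl.1, hl.2.1⟩
  exact hω.1.typeNumber

lemma one_le_typeNumber (hm : 1 ≤ m) {i : ℕ} {l : List ℤ} (hl : l ∈ LukPart m i) :
    1 ≤ typeNumber l := by
  rw [typeNumber_eq_typeOf hm hl]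
  exact one_le_typeOf (by rw [List.length_map]; exact length_rootSubtrees hl)

lemma mem_rootSubtrees (hm : 1 ≤ m) {i : ℕ} {l : List ℤ} (hl : l ∈ LukPart m i) :
    ∀ t ∈ rootSubtrees l, t = T0 ∨ ∃ j : Fin m, t ∈ LukPart m j := by
  obtain ⟨ω, hω, rfl⟩ := (bijOn_treeWord hm).surjOn ⟨hl.1, hl.2.1⟩
  rw [hω.1.forall_mem_rootSubtrees (Or.inl rfl)]
  rintro ⟨b, t⟩ hx
  have := hω.1 _ hx
  cases b with
  | one j => exact Or.inr ⟨j, this⟩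
  | oneT0 => exact Or.inl this
  | triple j => exact Or.inr ⟨j, this⟩
  | tripleT0 => exact Or.inl this

/-! ### The linear systems -/

/-- The trees of type at most `n`. -/
def typeLE (m n : ℕ) : Set (List ℤ) := {l | l ∈ Luk m ∧ typeNumber l ≤ n}

lemma typeLE_subset (n : ℕ) : typeLE m n ⊆ Luk m := fun _ h => h.1

/-- Trees other than `T0` have type at least `1`, so starting the sum at `k = 1` omits nothing. -/
lemma S_eq_SOf (hm : 1 ≤ m) (n : ℕ) : S m n = SOf m (typeLE m n) := by
  funext i
  have h1 : SumOn (typeLE m n ∩ LukPart m i) (treeExpr m) (SOf m (typeLE m n) i) :=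
    sumOn_treeSum (Set.inter_subset_left.trans (typeLE_subset n))
  have h2 : SumOn (Finset.Icc 1 n : Set ℕ) (J m i) (SOf m (typeLE m n) i) := by
    refine h1.fiberwise (p := typeNumber) (fun l hl => ?_) fun k hk => ?_
    · simp only [Finset.coe_Icc, Set.mem_Icc]
      exact ⟨one_le_typeNumber hm hl.2, hl.1.2⟩
    · simp only [Finset.coe_Icc, Set.mem_Icc] at hk
      change SumOn _ _ (treeSum m (LukType m i k))
      convert sumOn_treeSum (m := m) (X := LukType m i k) (fun l hl => hl.1.1) using 1
      ext l
      simp only [typeLE, LukType, Set.mem_inter_iff, Set.mem_ofPred_eq]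
      constructor
      · rintro ⟨⟨-, h1⟩, h2⟩
        exact ⟨h1, h2⟩
      · rintro ⟨h1, rfl⟩
        exact ⟨⟨⟨h1.1, hk.2⟩, h1⟩, rfl⟩
  exact (sumOn_finset _ _).unique h2

/-- The trees with exactly one root subtree of type `n`, the types of the others being smaller. -/
def oneOfType (m n : ℕ) (i : Fin m) : Set (List ℤ) :=
  {l | l ∈ LukPart m i ∧ (rootSubtrees l).countP (fun t => typeNumber t = n) = 1 ∧
    ∀ t ∈ rootSubtrees l, typeNumber t ≤ n}

/-- The restriction to root degree at least `2` only exempts `T0`, which has type `0` anyway. -/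
lemma mem_subtreesIn_typeLE_iff (hm : 1 ≤ m) {n : ℕ} {i : Fin m} {l : List ℤ}
    (hl : l ∈ LukPart m i) :
    l ∈ subtreesIn m (typeLE m n) ↔ ∀ t ∈ rootSubtrees l, typeNumber t ≤ n := by
  have h := mem_rootSubtrees hm hl
  constructor
  · intro h1 t ht
    rcases h t ht with rfl | ⟨j, hj⟩
    · rw [typeNumber_T0]
      exact Nat.zero_le n
    · exact (h1.2 t ht (two_le_rootDegree_of_mem_lukPart hj)).2
  · refine fun h1 => ⟨hl.1, fun t ht h2 => ⟨?_, h1 t ht⟩⟩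
    rcases h t ht with rfl | ⟨j, hj⟩
    · exact T0_mem_luk hm
    · exact hj.1

lemma typeLE_inter_lukPart (hm : 1 ≤ m) (n : ℕ) (i : Fin m) :
    typeLE m (n + 1) ∩ LukPart m i =
      (subtreesIn m (typeLE m n) ∩ LukPart m i) ∪ oneOfType m (n + 1) i := by
  ext l
  by_cases hl : l ∈ LukPart m i
  · have h0 : (rootSubtrees l).map typeNumber ≠ [] := by
      have := length_rootSubtrees hl
      intro h
      rw [List.map_eq_nil_iff] at h
      simp [h] at this
    have h1 : l ∈ typeLE m (n + 1) ↔ typeNumber l ≤ n + 1 := and_iff_right hl.1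
    simp only [Set.mem_inter_iff, Set.mem_union, hl, and_true, oneOfType, Set.mem_ofPred_eq,
      true_and, mem_subtreesIn_typeLE_iff hm hl, h1, typeNumber_eq_typeOf hm hl,
      typeOf_le_iff h0, List.forall_mem_map, List.count, List.countP_map, Nat.lt_succ_iff]
    rfl
  · simp [hl, oneOfType]

/-- Two members of a list at which a property holds are equal if it holds only once. -/
lemma eq_of_countP_eq_one {α : Type*} {p : α → Bool} {l : List α} (h : l.countP p = 1) {x y : α}
    (hx : x ∈ l) (hy : y ∈ l) (hpx : p x) (hpy : p y) : x = y := by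
  rw [List.countP_eq_length_filter] at h
  obtain ⟨z, hz⟩ := List.length_eq_one_iff.mp h
  have h1 : x ∈ l.filter p := List.mem_filter.mpr ⟨hx, hpx⟩
  have h2 : y ∈ l.filter p := List.mem_filter.mpr ⟨hy, hpy⟩
  rw [hz, List.mem_singleton] at h1 h2
  rw [h1, h2]

/-- The first root subtree of type `n`. -/
def subtreeOfType (n : ℕ) (l : List ℤ) : List ℤ :=
  ((rootSubtrees l).find? fun t => typeNumber t = n).getD T0

/-- The search succeeds because the count is positive, so the default `T0` plays no role. -/
lemma subtreeOfType_spec {n : ℕ} {i : Fin m} {l : List ℤ} (hl : l ∈ oneOfType m n i) :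
    subtreeOfType n l ∈ rootSubtrees l ∧ typeNumber (subtreeOfType n l) = n := by
  have h : 0 < (rootSubtrees l).countP (fun t => typeNumber t = n) := by rw [hl.2.1]; exact one_pos
  obtain ⟨t, ht, ht'⟩ := List.countP_pos_iff.mp h
  obtain ⟨t', ht''⟩ := Option.isSome_iff_exists.mp 
    (List.find?_isSome (p := fun t => decide (typeNumber t = n)) |>.mpr ⟨t, ht, ht'⟩)
  rw [subtreeOfType, ht'']
  exact ⟨List.mem_of_find?_eq_some ht'', by simpa using List.find?_some ht''⟩

/-- Identifies the fibres of `subtreeOfType` with the sets in the derivative property, taken for the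
trees of type at most `n`. -/
lemma mem_subtreesInWith_iff (hm : 1 ≤ m) {n : ℕ} {i j : Fin m} {T₁ : List ℤ}
    (hT₁ : T₁ ∈ LukType m j (n + 1)) {l : List ℤ} :
    l ∈ oneOfType m (n + 1) i ∧ subtreeOfType (n + 1) l = T₁ ↔
      l ∈ subtreesInWith m (typeLE m n) T₁ ∩ LukPart m i := by
  constructor
  · rintro ⟨hl, rfl⟩
    obtain ⟨h1, h2⟩ := subtreeOfType_spec hl
    have huniq : ∀ t ∈ rootSubtrees l, typeNumber t = n + 1 → t = subtreeOfType (n + 1) l :=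
      fun t ht htn => eq_of_countP_eq_one hl.2.1 ht h1 (by simpa using htn) (by simpa using h2)
    refine ⟨⟨hl.1.1, ?_, fun t ht hne hdeg => ⟨?_, ?_⟩⟩, hl.1⟩
    · rw [List.count]
      refine (List.countP_congr fun t ht => ?_).trans hl.2.1
      simp only [beq_iff_eq, decide_eq_true_eq]
      exact ⟨fun h => h ▸ h2, huniq t ht⟩
    · rcases mem_rootSubtrees hm hl.1 t ht with rfl | ⟨k, hk⟩
      · exact T0_mem_luk hm
      · exact hk.1
    · have h3 := hl.2.2 t ht
      have h4 : typeNumber t ≠ n + 1 := fun h => hne (huniq t ht h)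
      omega
  · rintro ⟨⟨-, h1, h2⟩, hl⟩
    have hle : ∀ t ∈ rootSubtrees l, t ≠ T₁ → typeNumber t ≤ n := by
      intro t ht hne
      rcases mem_rootSubtrees hm hl t ht with rfl | ⟨k, hk⟩
      · rw [typeNumber_T0]
        exact Nat.zero_le n
      · exact (h2 t ht hne (two_le_rootDegree_of_mem_lukPart hk)).2
    have hmem : l ∈ oneOfType m (n + 1) i := by
      refine ⟨hl, ?_, fun t ht => ?_⟩
      · refine (List.countP_congr fun t ht => ?_).trans h1
        simp only [beq_iff_eq, decide_eq_true_eq]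
        refine ⟨fun h => ?_, fun h => h ▸ hT₁.2⟩
        by_contra hne
        have := hle t ht hne
        omega
      · by_cases hne : t = T₁
        · exact (hne ▸ hT₁.2).le
        · exact (hle t ht hne).trans (Nat.le_succ n)
    obtain ⟨h3, h4⟩ := subtreeOfType_spec hmem
    refine ⟨hmem, ?_⟩
    by_contra hne
    have := hle _ h3 hne
    omega

/-- Trees are grouped by their unique root subtree `T₁` of type `n + 1`. The derivative property
applies since `T₁` has type greater than `n`; grouping the `T₁` by their capped number of terminal
zeros then produces the factors `J`. -/
lemma sum_J_mul_evalAt (hm : 1 ≤ m) (n : ℕ) (i : Fin m) :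
    ∑ j : Fin m, J m j (n + 1) * evalAt (partialDeriv j (auxFun m i)) (SOf m (typeLE m n)) =
      treeSum m (oneOfType m (n + 1) i) := by
  have h1 : SumOn (oneOfType m (n + 1) i) (treeExpr m) (treeSum m (oneOfType m (n + 1) i)) :=
    sumOn_treeSum fun l hl => hl.1.1
  have h2 : SumOn {t | ∃ j : Fin m, t ∈ LukType m j (n + 1)}
      (fun t => treeSum m (subtreesInWith m (typeLE m n) t ∩ LukPart m i))
      (treeSum m (oneOfType m (n + 1) i)) := by
    refine h1.fiberwise (p := subtreeOfType (n + 1)) (fun l hl => ?_) ?_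
    · obtain ⟨h3, h4⟩ := subtreeOfType_spec hl
      rcases mem_rootSubtrees hm hl.1 _ h3 with h5 | ⟨j, hj⟩
      · rw [h5, typeNumber_T0] at h4
        omega
      · exact ⟨j, hj, h4⟩
    · rintro t ⟨j, hj⟩
      convert sumOn_treeSum (m := m) (X := subtreesInWith m (typeLE m n) t ∩ LukPart m i)
        (fun l hl => hl.2.1) using 1
      ext l
      exact mem_subtreesInWith_iff hm hj
  have h3 : SumOn ((Finset.univ : Finset (Fin m)) : Set (Fin m))
      (fun j => J m j (n + 1) * evalAt (partialDeriv j (auxFun m i)) (SOf m (typeLE m n)))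
      (treeSum m (oneOfType m (n + 1) i)) := by
    refine h2.fiberwise (p := fun t => ⟨min (m - 1) (terminal t), by omega⟩)
      (fun _ _ => Finset.mem_coe.mpr (Finset.mem_univ _)) fun j _ => ?_
    have h4 : SumOn (LukType m j (n + 1)) (treeExpr m) (J m j (n + 1)) :=
      sumOn_treeSum fun l hl => hl.1.1
    have h5 := (h4.const_mul (evalAt (partialDeriv j (auxFun m i)) (SOf m (typeLE m n)))).congr
      (t := fun t => treeSum m (subtreesInWith m (typeLE m n) t ∩ LukPart m i)) fun t ht => by
        rw [mul_comm]
        refine treeExpr_mul_evalAt_partialDeriv hm (typeLE_subset n) i ht.1 fun h => ?_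
        have h1 := ht.2
        have h2 := h.2
        omega
    rw [mul_comm]
    convert h5 using 1
    ext t
    simp only [Set.mem_ofPred_eq]
    constructor
    · rintro ⟨⟨k, hk⟩, rfl⟩
      have h6 := ((mem_lukPart_iff k.2).mp hk.1).2.2
      rwa [← h6] at hk
    · intro ht
      exact ⟨⟨j, ht⟩, Fin.ext ((mem_lukPart_iff j.2).mp ht.1).2.2⟩
  exact (sumOn_finset _ _).unique h3

/-- `L_m(f_{i,m}, n)` is the sum of all trees of type at most `n`. -/
lemma linearPart_auxFun (hm : 1 ≤ m) (n : ℕ) (i : Fin m) :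
    linearPart m (auxFun m i) (n + 1) = S m (n + 1) i := by
  rw [linearPart, Nat.add_sub_cancel, S_eq_SOf hm n, S_eq_SOf hm (n + 1),
    sum_J_mul_evalAt hm, evalAt_auxFun_SOf hm (typeLE_subset n)]
  refine SumOn.unique (SumOn.union (sumOn_treeSum fun l hl => hl.2.1)
    (sumOn_treeSum fun l hl => hl.1.1) ?_) (typeLE_inter_lukPart hm n i ▸
      sumOn_treeSum (m := m) (Set.inter_subset_left.trans (typeLE_subset (n + 1))))
  rw [Set.disjoint_left]
  rintro l ⟨h1, hl⟩ h2
  obtain ⟨h3, h4⟩ := subtreeOfType_spec h2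
  have := (mem_subtreesIn_typeLE_iff hm hl).mp h1 _ h3
  omega

end NRS

end

theorem mainTheorem4 (m : ℕ) (hm : 1 ≤ m) :
    -- the sums of trees are well-defined elements of `R_m`
    (∀ X : Set (List ℤ), X ⊆ NRS.Luk m →
      NRS.FormallySummable (fun T : X => NRS.treeExpr m T.1) ∧ NRS.treeSum m X ∈ NRS.R m) ∧
    -- the sums that define the coefficients of the auxiliary functions are well defined
    (∀ (i : Fin m) (α : Fin m →₀ ℕ), NRS.FormallySummable
      (fun T : {T : NRS.PartialTree m // NRS.PartialTree.terminal T = i} =>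
        MvPolynomial.coeff α (NRS.PartialTree.expr T.1))) ∧
    -- substitution property
    (∀ X : Set (List ℤ), X ⊆ NRS.Luk m → ∀ i : Fin m,
      NRS.EvalSummable (NRS.auxFun m i) (NRS.SOf m X) ∧
      NRS.evalAt (NRS.auxFun m i) (NRS.SOf m X) =
        NRS.treeSum m (NRS.subtreesIn m X ∩ NRS.LukPart m i)) ∧
    -- derivative property
    (∀ X : Set (List ℤ), X ⊆ NRS.Luk m → ∀ i j : Fin m, ∀ T₁ ∈ NRS.LukPart m j, T₁ ∉ X →
      NRS.EvalSummable (NRS.partialDeriv j (NRS.auxFun m i)) (NRS.SOf m X) ∧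
      NRS.treeExpr m T₁ * NRS.evalAt (NRS.partialDeriv j (NRS.auxFun m i)) (NRS.SOf m X) =
        NRS.treeSum m (NRS.subtreesInWith m X T₁ ∩ NRS.LukPart m i)) ∧
    -- all values occurring in the linear systems are well defined
    (∀ (n : ℕ) (i j : Fin m),
      NRS.EvalSummable (NRS.auxFun m i) (NRS.S m n) ∧
      NRS.EvalSummable (NRS.partialDeriv j (NRS.auxFun m i)) (NRS.S m n)) ∧
    -- the linear systems
    (∀ i : Fin m, NRS.J m i 1 = NRS.linearPart m (NRS.auxFun m i) 1) ∧
    (∀ n : ℕ, 1 ≤ n → ∀ i : Fin m, NRS.J m i (n + 1) =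
      NRS.linearPart m (NRS.auxFun m i) (n + 1) - NRS.linearPart m (NRS.auxFun m i) n) := by
  have hlow : ∀ n (j : Fin m), NRS.LowBd ((j : ℕ) + 1) (NRS.S m n j) := fun n j => by
    rw [NRS.S_eq_SOf hm n]
    exact NRS.lowBd_SOf (NRS.typeLE_subset n) j
  refine ⟨fun X hX => ⟨NRS.formallySummable_coe_iff.mpr (NRS.summableOn_treeExpr hX),
      NRS.treeSum_mem_R hX⟩,
    fun i α => NRS.formallySummable_coe_iff.mpr
      (NRS.summableOn_coeff_expr (NRS.partialTrees i) α),
    fun X hX i => ⟨(NRS.evalAt_auxFun (NRS.lowBd_SOf hX) i).1, NRS.evalAt_auxFun_SOf hm hX i⟩,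
    fun X hX i j T₁ hT₁ hT₁X => ⟨(NRS.evalAt_partialDeriv (NRS.lowBd_SOf hX) i j).1,
      NRS.treeExpr_mul_evalAt_partialDeriv hm hX i hT₁ hT₁X⟩,
    fun n i j => ⟨(NRS.evalAt_auxFun (hlow n) i).1, (NRS.evalAt_partialDeriv (hlow n) i j).1⟩,
    fun i => ?_, fun n hn i => ?_⟩
  · rw [NRS.linearPart_auxFun hm 0 i]
    simp [NRS.S]
  -- Both linear parts are now partial sums, `S` at `k + 2` and at `k + 1`, and their difference is
  -- the last summand.
  · obtain ⟨k, rfl⟩ : ∃ k, n = k + 1 := ⟨n - 1, by omega⟩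
    rw [NRS.linearPart_auxFun hm (k + 1) i, NRS.linearPart_auxFun hm k i, NRS.S, NRS.S,
      Finset.sum_Icc_succ_top (by omega), add_sub_cancel_left]
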